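/- Let $y_j=\theta_j+\sigma\xi_j$, $j=1,\dots,d$, where $\theta\in\mathbb R^d$ is unknown, $\sigma>0$ and $\xi_1,\dots,\xi_d$ are i.i.d. standard normal, and let $\mathbf P_\theta$ be the law of $y=(y_1,\dots,y_d)$. Let $\|\theta\|_0$ be the number of non-zero components of $\theta$, $\|\theta\|_q=(\sum_{i}|\theta_i|^q)^{1/q}$ for $q>0$, $B_0(s)=\{\theta\in\mathbb R^d:\|\theta\|_0\le s\}$, $B_q(r)=\{\theta\in\mathbb R^d:\|\theta\|_q\le r\}$, and $\Theta_{q,u}(\delta)=\{\theta\in B_q(u):\|\theta\|_2\ge\delta\}$ for $q\ge0$. For testing $\theta=0$ against $\theta\in\Theta_{q,u}(\delta)$ define the minimax risk $$\mathcal R_{q,u}(\delta)=\inf_\Delta\Big\{\mathbf P_0(\Delta=1)+\sup_{\theta\in\Theta_{q,u}(\delta)}\mathbf P_\theta(\Delta=0)\Big\},$$ where the infimum is over all $\{0,1\}$-valued statistics $\Delta=\Delta(y)$ and the supremum over an empty set is $0$. 1. For integers $1\le s\le d$ and $\sigma>0$ put $\psi_\sigma^{\sqrt Q}(s,d)=\sigma^2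 s\log(1+d/s^2)$ if $s<\sqrt d$ and $\psi_\sigma^{\sqrt Q}(s,d)=\sigma^2\sqrt d$ if $s\ge\sqrt d$. Then $\lambda=\big(\psi_\sigma^{\sqrt Q}(s,d)\big)^{1/2}$ is the non-asymptotic minimax rate of testing on $\Theta_{0,s}$, that is, $\lambda>0$ and: (i) for every $\varepsilon\in(0,1)$ there is $A_\varepsilon>0$ such that $\mathcal R_{0,s}(A\lambda)\le\varepsilon$ for all $A>A_\varepsilon$; (ii) for every $\varepsilon\in(0,1)$ there is $a_\varepsilon>0$ such that $\mathcal R_{0,s}(A\lambda)\ge1-\varepsilon$ for all $0<A<a_\varepsilon$. Here $A_\varepsilon$ and $a_\varepsilon$ depend only on $\varepsilon$, and not on $s,d,\sigma$. 2. Let $0<q<2$. For an integer $d\ge1$ and $r,\sigma>0$ let $m\in\{0,1,2,\dots\}\cup\{\infty\}$ be the largest $s$ such that $\sigma^2\log(1+d/t^2)\le r^2t^{-2/q}$ for all integers $1\le t\le s$ ($m=0$ if this fails for $t=1$, and $m=\infty$ if it holds for all $t\ge1$). Put $$\psi_{\sigma,q}^{\sqrt Q}(r,d)=\begin{cases}\sigma^2\sqrt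 d & \text{if } m>\sqrt d,\\ \sigma^2m\log(1+d/m^2) & \text{if } 1\le m\le\sqrt d,\\ r^2 & \text{if } m=0.\end{cases}$$ Then $\lambda=\big(\psi_{\sigma,q}^{\sqrt Q}(r,d)\big)^{1/2}$ is the minimax rate of testing on $\Theta_{q,r}$: $\lambda>0$, and (i) and (ii) hold with $\mathcal R_{q,r}$ in place of $\mathcal R_{0,s}$, where $A_\varepsilon$ and $a_\varepsilon$ depend only on $\varepsilon$ and $q$, and not on $d,r,\sigma$. -/

import Mathlib

open MeasureTheory ProbabilityTheory
open scoped ENNReal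

noncomputable section

namespace SparseTesting

/-- The law of the observations `y_j = θ_j + σ ξ_j`, `j = 1, …, d`, with `ξ_j` i.i.d. standard
normal. -/
def obsLaw {d : ℕ} (σ : ℝ) (θ : Fin d → ℝ) : Measure (Fin d → ℝ) :=
  (Measure.pi fun _ : Fin d => gaussianReal 0 1).map fun ξ j => θ j + σ * ξ j

/-- The number `‖θ‖₀` of non-zero components. -/
def l0 {d : ℕ} (θ : Fin d → ℝ) : ℕ :=
  Set.ncard {j | θ j ≠ 0}

/-- `‖θ‖_q = (∑ |θ_i|^q)^(1/q)` for `q > 0`. -/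
def lq {d : ℕ} (q : ℝ) (θ : Fin d → ℝ) : ℝ :=
  (∑ i, |θ i| ^ q) ^ (1 / q)

/-- The Euclidean norm `‖θ‖₂ = √(∑ θ_i²)`. -/
def l2 {d : ℕ} (θ : Fin d → ℝ) : ℝ :=
  √(∑ i, θ i ^ 2)

/-- The alternative `{θ ∈ B_0(s) : ‖θ‖₂ ≥ δ}`. -/
def sparseAlt (d s : ℕ) (δ : ℝ) : Set (Fin d → ℝ) :=
  {θ | l0 θ ≤ s ∧ δ ≤ l2 θ}

/-- The alternative `{θ ∈ B_q(r) : ‖θ‖₂ ≥ δ}`, for `q > 0`. -/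
def ballAlt (d : ℕ) (q r δ : ℝ) : Set (Fin d → ℝ) :=
  {θ | lq q θ ≤ r ∧ δ ≤ l2 θ}

/-- The risk of the `{0,1}`-valued test `Δ` of `θ = 0` against `θ ∈ Θ`: first type error plus
maximum second type error (the latter is `0` if `Θ` is empty). -/
def testRisk {d : ℕ} (σ : ℝ) (Θ : Set (Fin d → ℝ)) (Δ : (Fin d → ℝ) → Fin 2) : ℝ≥0∞ :=
  obsLaw σ 0 {y | Δ y = 1} + ⨆ θ ∈ Θ, obsLaw σ θ {y | Δ y = 0}

/-- The minimax risk of testing `θ = 0` against `θ ∈ Θ`: infimum over all `{0,1}`-valued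
statistics. -/
def minimaxRisk {d : ℕ} (σ : ℝ) (Θ : Set (Fin d → ℝ)) : ℝ≥0∞ :=
  ⨅ (Δ : (Fin d → ℝ) → Fin 2) (_ : Measurable Δ), testRisk σ Θ Δ

/-- The rate `ψ` on `B_0(s)`. -/
def psiSparse (d s : ℕ) (σ : ℝ) : ℝ :=
  if (s : ℝ) < √d then σ ^ 2 * s * Real.log (1 + d / (s : ℝ) ^ 2) else σ ^ 2 * √d

/-- The effective sparsity `m` of the ball `B_q(r)`: the largest `s` such that
`σ² log(1 + d/t²) ≤ r² t^(-2/q)` for all integers `1 ≤ t ≤ s`; it is `0` if the inequality fails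
at `t = 1`, and `⊤` if the inequality never fails. For `q ≤ 1` the inequality at `s` implies the
inequality at all `1 ≤ t ≤ s`, so that `m` is the largest `s ≥ 1` where it holds. -/
def effSparsity (d : ℕ) (q r σ : ℝ) : ℕ∞ :=
  ⨆ s ∈ {s : ℕ | 1 ≤ s ∧ ∀ t : ℕ, 1 ≤ t → t ≤ s →
    σ ^ 2 * Real.log (1 + d / (t : ℝ) ^ 2) ≤ r ^ 2 * (t : ℝ) ^ (-2 / q)}, (s : ℕ∞)

/-- The rate `ψ` on `B_q(r)`: dense zone `m > √d` (including `m = ⊤`), sparse zone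
`1 ≤ m ≤ √d`, degenerate zone `m = 0`. -/
def psiBall (d : ℕ) (q r σ : ℝ) : ℝ :=
  let m := effSparsity d q r σ
  if m = ⊤ ∨ √d < (m.toNat : ℝ) then σ ^ 2 * √d
  else if 1 ≤ m then σ ^ 2 * m.toNat * Real.log (1 + d / (m.toNat : ℝ) ^ 2)
  else r ^ 2

end SparseTesting

end

/-!
By scaling, `σ = 1`. Write `L = log (1 + d / s²)`.

*Lower bound.* For `s ≤ √d`, split the coordinates into `s` blocks of equal size `b ≍ d / s` and let
`θ` have one entry `τ` in each block, at an independent uniform position. The second moment under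
`P_0` of the mixture likelihood ratio factorizes over the blocks as
`(1 + (exp τ² - 1) / b)^s`, and it is close to `1` when `τ² ≤ a L` with `a` small. Hence no test
detects these vectors, whose Euclidean norm is `√s τ`.

*Upper bound.* The statistic `∑ (|y_j| - t)_+²` with `t = 4 √L` (or `t = 0` in the dense zone) has
a mean that grows by at least `θ_j² / 8` for each coordinate with `|θ_j| > 2t`, and its variance is
at most a constant times `(s L)² + ‖θ‖₂²` (`d + ‖θ‖₂²` in the dense zone). Chebyshev's inequality
applies once the coordinates with `|θ_j| ≤ 2t` carry only part of `‖θ‖₂²`.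

*Balls.* With `m` the effective sparsity of `B_q(r)`, the ball contains the flat `m`-sparse vectors
of height `√L`, which gives the lower bound. Failure of the defining inequality at `m + 1` gives
`r^q ≲ m L^(q/2)`, so the coordinates of `θ ∈ B_q(r)` that are at most `8 √L` in absolute value
contribute at most a constant times `m L` to `‖θ‖₂²`, as for an `m`-sparse vector.
-/

namespace SparseTesting

section Likelihood

variable {ι : Type*} [Fintype ι]

/-- The law `N(h, I)` of a Gaussian vector with mean `h` and identity covariance: the observations
in the case `σ = 1`. -/
noncomputable abbrev gaussianShift (h : ι → ℝ) : Measure (ι → ℝ) :=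
  Measure.pi fun j => gaussianReal (h j) 1

/-- The density of `N(h, I)` with respect to `N(0, I)`. -/
noncomputable def likelihood (h z : ι → ℝ) : ℝ :=
  ∏ j, Real.exp (h j * z j - h j ^ 2 / 2)

lemma likelihood_nonneg (h z : ι → ℝ) : 0 ≤ likelihood h z :=
  Finset.prod_nonneg fun _ _ => (Real.exp_pos _).le

lemma integrable_exp_mul_sub_gaussianReal (a b : ℝ) :
    Integrable (fun x => Real.exp (a * x - b)) (gaussianReal 0 1) := by
  simp_rw [Real.exp_sub, div_eq_mul_inv]
  exact (integrable_exp_mul_gaussianReal a).mul_const _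

lemma integral_exp_mul_sub_gaussianReal (a b : ℝ) :
    ∫ x, Real.exp (a * x - b) ∂gaussianReal 0 1 = Real.exp (a ^ 2 / 2 - b) := by
  have hmgf := congrFun (mgf_fun_id_gaussianReal (μ := 0) (v := 1)) a
  simp only [mgf, zero_mul, zero_add, NNReal.coe_one, one_mul] at hmgf
  simp_rw [Real.exp_sub, div_eq_mul_inv (Real.exp _)]
  rw [integral_mul_const, hmgf]

lemma integrable_likelihood (h : ι → ℝ) : Integrable (likelihood h) (gaussianShift (0 : ι → ℝ)) :=
  Integrable.fintype_prod (f := fun j x => Real.exp (h j * x - h j ^ 2 / 2))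
    fun _ => integrable_exp_mul_sub_gaussianReal _ _

lemma integral_likelihood (h : ι → ℝ) :
    ∫ z, likelihood h z ∂gaussianShift (0 : ι → ℝ) = 1 := by
  unfold likelihood
  rw [integral_fintype_prod_eq_prod (f := fun j x => Real.exp (h j * x - h j ^ 2 / 2))]
  simp [integral_exp_mul_sub_gaussianReal]

lemma likelihood_mul_likelihood (h h' z : ι → ℝ) :
    likelihood h z * likelihood h' z = Real.exp (∑ j, h j * h' j) * likelihood (h + h') z := by
  simp only [likelihood, Real.exp_sum, ← Finset.prod_mul_distrib, ← Real.exp_add, Pi.add_apply]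
  exact Finset.prod_congr rfl fun j _ => by ring_nf

lemma integrable_likelihood_mul (h h' : ι → ℝ) :
    Integrable (fun z => likelihood h z * likelihood h' z) (gaussianShift (0 : ι → ℝ)) := by
  simp_rw [likelihood_mul_likelihood]
  exact (integrable_likelihood _).const_mul _

lemma integral_likelihood_mul (h h' : ι → ℝ) :
    ∫ z, likelihood h z * likelihood h' z ∂gaussianShift (0 : ι → ℝ) =
      Real.exp (∑ j, h j * h' j) := by
  simp_rw [likelihood_mul_likelihood]
  rw [integral_const_mul, integral_likelihood, mul_one]

lemma gaussianReal_apply_eq_setIntegral_exp (h : ℝ) {s : Set ℝ} (hs : MeasurableSet s) :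
    gaussianReal h 1 s =
      ENNReal.ofReal (∫ x in s, Real.exp (h * x - h ^ 2 / 2) ∂gaussianReal 0 1) := by
  have hpdf : ∀ x, gaussianPDFReal h 1 x =
      gaussianPDFReal 0 1 x * Real.exp (h * x - h ^ 2 / 2) := fun x => by
    simp only [gaussianPDFReal, NNReal.coe_one, mul_assoc, ← Real.exp_add]
    ring_nf
  rw [gaussianReal_apply_eq_integral h one_ne_zero, ← integral_indicator hs,
    ← integral_indicator hs, integral_gaussianReal_eq_integral_smul one_ne_zero]
  congr 2 with x
  by_cases hx : x ∈ s <;> simp [hx, hpdf]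

lemma gaussianShift_eq_withDensity_likelihood (h : ι → ℝ) :
    gaussianShift h =
      (gaussianShift (0 : ι → ℝ)).withDensity fun z => ENNReal.ofReal (likelihood h z) := by
  refine Measure.pi_eq fun s hs => ?_
  rw [withDensity_apply _ (MeasurableSet.univ_pi hs),
    ← ofReal_integral_eq_lintegral_ofReal (integrable_likelihood h).restrict
      (ae_of_all _ fun z => likelihood_nonneg h z), Measure.restrict_pi_pi]
  unfold likelihood
  rw [integral_fintype_prod_eq_prod (f := fun j x => Real.exp (h j * x - h j ^ 2 / 2)),
    ENNReal.ofReal_prod_of_nonneg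
      fun j _ => integral_nonneg fun _ => (Real.exp_pos _).le]
  exact Finset.prod_congr rfl fun j _ => (gaussianReal_apply_eq_setIntegral_exp (h j) (hs j)).symm

lemma gaussianShift_real_eq_setIntegral_likelihood (h : ι → ℝ) {B : Set (ι → ℝ)}
    (hB : MeasurableSet B) :
    (gaussianShift h).real B = ∫ z in B, likelihood h z ∂gaussianShift (0 : ι → ℝ) := by
  have hnonneg : ∀ z, 0 ≤ likelihood h z := likelihood_nonneg h
  rw [measureReal_def, gaussianShift_eq_withDensity_likelihood, withDensity_apply _ hB,
    ← ofReal_integral_eq_lintegral_ofReal (integrable_likelihood h).restrict (ae_of_all _ hnonneg),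
    ENNReal.toReal_ofReal (integral_nonneg hnonneg)]

variable {κ : Type*} [Fintype κ]

/-- The density, with respect to `N(0, I)`, of the mixture of the laws `N(h i, I)` with `i` uniform
on the finite type `κ`. -/
noncomputable def mixtureLikelihood (h : κ → ι → ℝ) (z : ι → ℝ) : ℝ :=
  (Fintype.card κ : ℝ)⁻¹ * ∑ i, likelihood (h i) z

lemma mixtureLikelihood_sq (h : κ → ι → ℝ) (z : ι → ℝ) :
    mixtureLikelihood h z ^ 2 =
      ((Fintype.card κ : ℝ) ^ 2)⁻¹ * ∑ i, ∑ i', likelihood (h i) z * likelihood (h i') z := by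
  simp only [mixtureLikelihood, mul_pow, inv_pow, sq (∑ i, likelihood (h i) z), Finset.sum_mul_sum]

lemma integrable_mixtureLikelihood (h : κ → ι → ℝ) :
    Integrable (mixtureLikelihood h) (gaussianShift (0 : ι → ℝ)) :=
  (integrable_finsetSum _ fun i _ => integrable_likelihood (h i)).const_mul _

lemma memLp_mixtureLikelihood (h : κ → ι → ℝ) :
    MemLp (mixtureLikelihood h) 2 (gaussianShift (0 : ι → ℝ)) := by
  rw [memLp_two_iff_integrable_sq (integrable_mixtureLikelihood h).1]
  simp_rw [mixtureLikelihood_sq]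
  exact (integrable_finsetSum _ fun i _ => integrable_finsetSum _ fun i' _ =>
    integrable_likelihood_mul (h i) (h i')).const_mul _

lemma integral_mixtureLikelihood [Nonempty κ] (h : κ → ι → ℝ) :
    ∫ z, mixtureLikelihood h z ∂gaussianShift (0 : ι → ℝ) = 1 := by
  simp only [mixtureLikelihood]
  rw [integral_const_mul, integral_finsetSum _ fun i _ => integrable_likelihood (h i)]
  simp [integral_likelihood]

lemma integral_mixtureLikelihood_sq (h : κ → ι → ℝ) :
    ∫ z, mixtureLikelihood h z ^ 2 ∂gaussianShift (0 : ι → ℝ) =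
      ((Fintype.card κ : ℝ) ^ 2)⁻¹ * ∑ i, ∑ i', Real.exp (∑ j, h i j * h i' j) := by
  simp_rw [mixtureLikelihood_sq]
  rw [integral_const_mul, integral_finsetSum _ fun i _ => integrable_finsetSum _ fun i' _ =>
    integrable_likelihood_mul (h i) (h i')]
  simp_rw [integral_finsetSum _ fun i' _ => integrable_likelihood_mul (h _) (h i'),
    integral_likelihood_mul]

lemma exists_setIntegral_mixtureLikelihood_le [Nonempty κ] (h : κ → ι → ℝ) {B : Set (ι → ℝ)}
    (hB : MeasurableSet B) :
    ∃ i, ∫ z in B, mixtureLikelihood h z ∂gaussianShift (0 : ι → ℝ) ≤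
      (gaussianShift (h i)).real B := by
  have hcard : (Fintype.card κ : ℝ) ≠ 0 := by exact_mod_cast Fintype.card_ne_zero
  have haverage : ∫ z in B, mixtureLikelihood h z ∂gaussianShift (0 : ι → ℝ) =
      (Fintype.card κ : ℝ)⁻¹ * ∑ i, (gaussianShift (h i)).real B := by
    simp only [mixtureLikelihood, gaussianShift_real_eq_setIntegral_likelihood _ hB]
    rw [integral_const_mul, integral_finsetSum _ fun i _ => (integrable_likelihood (h i)).restrict]
  obtain ⟨i, -, hi⟩ := Finset.exists_le_of_sum_le (s := Finset.univ) (Finset.univ_nonempty (α := κ))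
    (f := fun _ => ∫ z in B, mixtureLikelihood h z ∂gaussianShift (0 : ι → ℝ))
    (g := fun i => (gaussianShift (h i)).real B) (by
      rw [haverage, Finset.sum_const, Finset.card_univ, nsmul_eq_mul, mul_inv_cancel_left₀ hcard])
  exact ⟨i, hi⟩

end Likelihood

section SecondMoment

/-- Cauchy–Schwarz bounds the total variation distance by the `χ²` divergence `∫ L² - 1`. -/
lemma measureReal_sub_setIntegral_le {Ω : Type*} [MeasurableSpace Ω] {μ : Measure Ω}
    [IsProbabilityMeasure μ] {L : Ω → ℝ} {ε : ℝ} (hε : 0 ≤ ε) (hL : MemLp L 2 μ)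
    (hmean : ∫ x, L x ∂μ = 1) (hsq : ∫ x, L x ^ 2 ∂μ ≤ 1 + ε ^ 2) (B : Set Ω) :
    μ.real B - ∫ x in B, L x ∂μ ≤ ε := by
  have hLi : Integrable L μ := hL.integrable one_le_two
  have hdev : MemLp (fun x => |L x - 1|) 2 μ := (hL.sub (memLp_const 1)).abs
  have hchi : ∫ x, |L x - 1| ^ 2 ∂μ ≤ ε ^ 2 := by
    have hvar := variance_eq_integral hLi.aemeasurable
    rw [variance_eq_sub hL, hmean] at hvar
    simp only [sq_abs]
    simp only [Pi.pow_apply] at hvar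
    linarith
  have habs : ∫ x, |L x - 1| ∂μ ≤ ε := by
    refine le_of_sq_le_sq ?_ hε
    have hvar := variance_nonneg (fun x => |L x - 1|) μ
    rw [variance_eq_sub hdev] at hvar
    simp only [Pi.pow_apply] at hvar
    linarith
  calc μ.real B - ∫ x in B, L x ∂μ = ∫ x in B, (1 - L x) ∂μ := by
        rw [integral_sub (integrable_const _) hLi.restrict]
        simp
    _ ≤ ∫ x in B, |L x - 1| ∂μ :=
        integral_mono ((integrable_const _).sub hLi.restrict) (hdev.integrable one_le_two).restrict
          fun x => (le_abs_self _).trans (abs_sub_comm _ _).le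
    _ ≤ ∫ x, |L x - 1| ∂μ :=
        setIntegral_le_integral (hdev.integrable one_le_two) (ae_of_all _ fun _ => abs_nonneg _)
    _ ≤ ε := habs

lemma obsLaw_one {d : ℕ} (θ : Fin d → ℝ) : obsLaw 1 θ = gaussianShift θ := by
  simp only [obsLaw, one_mul]
  rw [Measure.pi_map_pi (f := fun j x => θ j + x) fun j => by fun_prop]
  simp [gaussianReal_map_const_add]

lemma compl_setOf_eq_zero {α : Type*} (Δ : α → Fin 2) : {y | Δ y = 0}ᶜ = {y | Δ y = 1} := by
  ext y
  simp only [Set.mem_compl_iff, Set.mem_ofPred_eq]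
  omega

/-- The second moment method, with the uniform prior on the alternatives `h i`. -/
lemma le_minimaxRisk_of_sum_exp_le {d : ℕ} {ε : ℝ} (hε : 0 ≤ ε) {Θ : Set (Fin d → ℝ)}
    {κ : Type*} [Fintype κ] [Nonempty κ] (h : κ → Fin d → ℝ) (hΘ : ∀ i, h i ∈ Θ)
    (hsum : ∑ i, ∑ i', Real.exp (∑ j, h i j * h i' j) ≤ (1 + ε ^ 2) * (Fintype.card κ : ℝ) ^ 2) :
    ENNReal.ofReal (1 - ε) ≤ minimaxRisk 1 Θ := by
  refine le_iInf₂ fun Δ hΔ => ?_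
  have hB : MeasurableSet {y | Δ y = 0} := hΔ (measurableSet_singleton 0)
  have : (0 : ℝ) < Fintype.card κ := by exact_mod_cast Fintype.card_pos
  have hsq : ∫ z, mixtureLikelihood h z ^ 2 ∂gaussianShift (0 : Fin d → ℝ) ≤ 1 + ε ^ 2 := by
    rw [integral_mixtureLikelihood_sq, inv_mul_le_iff₀ (by positivity), mul_comm]
    exact hsum
  have htv := measureReal_sub_setIntegral_le hε (memLp_mixtureLikelihood h)
    (integral_mixtureLikelihood h) hsq {y | Δ y = 0}
  obtain ⟨i, hi⟩ := exists_setIntegral_mixtureLikelihood_le h hB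
  have htypeII : ENNReal.ofReal ((gaussianShift (h i)).real {y | Δ y = 0}) ≤
      ⨆ θ ∈ Θ, obsLaw 1 θ {y | Δ y = 0} := by
    rw [ofReal_measureReal, ← obsLaw_one]
    exact le_iSup₂_of_le (h i) (hΘ i) le_rfl
  have htypeI : obsLaw 1 0 {y | Δ y = 1} =
      ENNReal.ofReal (1 - (gaussianShift (0 : Fin d → ℝ)).real {y | Δ y = 0}) := by
    rw [← probReal_compl_eq_one_sub hB, ofReal_measureReal, compl_setOf_eq_zero, obsLaw_one]
  rw [testRisk, htypeI]
  refine le_trans ?_ (add_le_add le_rfl htypeII)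
  rw [← ENNReal.ofReal_add (sub_nonneg.2 measureReal_le_one) measureReal_nonneg]
  exact ENNReal.ofReal_le_ofReal (by linarith)

end SecondMoment

section FlatVectors

variable {ι κ β : Type*}

/-- The vector that equals `τ` on `S` and vanishes elsewhere: the hardest alternatives are of this
form. -/
def flatVector [DecidableEq ι] (S : Finset ι) (τ : ℝ) : ι → ℝ :=
  fun j => if j ∈ S then τ else 0

lemma sum_flatVector_mul_flatVector [Fintype ι] [DecidableEq ι] (S S' : Finset ι) (τ : ℝ) :
    ∑ j, flatVector S τ j * flatVector S' τ j = τ ^ 2 * (S ∩ S').card := by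
  simp only [flatVector, mul_ite, ite_mul, zero_mul, mul_zero, ← ite_and, ← Finset.mem_inter]
  rw [Finset.sum_ite_mem, Finset.univ_inter, Finset.sum_const, nsmul_eq_mul, mul_comm, sq,
    Finset.inter_comm]

lemma sum_flatVector_sq [Fintype ι] [DecidableEq ι] (S : Finset ι) (τ : ℝ) :
    ∑ j, flatVector S τ j ^ 2 = S.card * τ ^ 2 := by
  simp [flatVector, ite_pow]

/-- The image under `e` of the graph of `f`. If `e` cuts `ι` into blocks indexed by `κ`, this is the
support that meets the block `k` in the single point `e (k, f k)`. -/
def blockSupport [Fintype κ] (e : κ × β ↪ ι) (f : κ → β) : Finset ι :=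
  Finset.univ.map ⟨fun k => e (k, f k), fun _ _ h => congrArg Prod.fst (e.injective h)⟩

lemma card_blockSupport [Fintype κ] (e : κ × β ↪ ι) (f : κ → β) :
    (blockSupport e f).card = Fintype.card κ :=
  Finset.card_map _

lemma mem_blockSupport [Fintype κ] {e : κ × β ↪ ι} {f : κ → β} {j : ι} :
    j ∈ blockSupport e f ↔ ∃ k, e (k, f k) = j := by
  simp only [blockSupport, Finset.mem_map, Finset.mem_univ, true_and]
  rfl

lemma card_blockSupport_inter [Fintype κ] [DecidableEq ι] [DecidableEq β] (e : κ × β ↪ ι)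
    (f f' : κ → β) :
    (blockSupport e f ∩ blockSupport e f').card =
      (Finset.univ.filter fun k => f k = f' k).card := by
  refine (Finset.card_bij (fun k _ => e (k, f k)) (fun k hk => ?_)
    (fun _ _ _ _ h => congrArg Prod.fst (e.injective h)) fun j hj => ?_).symm
  · rw [Finset.mem_inter, mem_blockSupport, mem_blockSupport]
    exact ⟨⟨k, rfl⟩, k, by rw [(Finset.mem_filter.1 hk).2]⟩
  · rw [Finset.mem_inter, mem_blockSupport, mem_blockSupport] at hj
    obtain ⟨⟨k, rfl⟩, k', hk'⟩ := hj
    obtain ⟨rfl, hf⟩ := Prod.ext_iff.1 (e.injective hk')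
    exact ⟨k', Finset.mem_filter.2 ⟨Finset.mem_univ _, hf.symm⟩, rfl⟩

lemma sum_exp_mul_card_agree [Fintype κ] [Fintype β] [DecidableEq κ] [DecidableEq β] (f : κ → β)
    (v : ℝ) :
    ∑ f' : κ → β, Real.exp (v * (Finset.univ.filter fun k => f k = f' k).card) =
      (Fintype.card β - 1 + Real.exp v) ^ Fintype.card κ := by
  have hfactor : ∀ f' : κ → β, Real.exp (v * (Finset.univ.filter fun k => f k = f' k).card) =
      ∏ k, if f k = f' k then Real.exp v else 1 := fun f' => by
    rw [Finset.prod_ite, Finset.prod_const_one, mul_one, Finset.prod_const, ← Real.exp_nat_mul,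
      mul_comm]
  have hblock : ∀ i : β, ∑ i', (if i = i' then Real.exp v else 1) =
      Fintype.card β - 1 + Real.exp v := fun i => by
    have hsplit : ∀ i', (if i = i' then Real.exp v else 1) =
        (if i = i' then Real.exp v - 1 else 0) + 1 := fun i' => by split_ifs <;> ring
    simp_rw [hsplit, Finset.sum_add_distrib, Finset.sum_ite_eq, Finset.sum_const]
    simp only [Finset.mem_univ, if_true, Finset.card_univ, nsmul_eq_mul, mul_one]
    ring
  simp_rw [hfactor]
  rw [← Fintype.prod_sum (f := fun k i' => if f k = i' then Real.exp v else 1)]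
  simp_rw [hblock, Finset.prod_const, Finset.card_univ]

end FlatVectors

section SparseLowerBound

/-- The factor `log (1 + d / s²)` of the rates. -/
noncomputable def sparseLog (d s : ℕ) : ℝ :=
  Real.log (1 + d / (s : ℝ) ^ 2)

lemma exp_sparseLog (d s : ℕ) : Real.exp (sparseLog d s) = 1 + d / (s : ℝ) ^ 2 :=
  Real.exp_log (by positivity)

lemma half_le_sparseLog {d s : ℕ} (hs : 1 ≤ s) (hsd : s ^ 2 ≤ d) : 1 / 2 ≤ sparseLog d s := by
  have : (0 : ℝ) < s := by exact_mod_cast hs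
  have hratio : 1 ≤ d / (s : ℝ) ^ 2 := by
    rw [one_le_div (by positivity)]
    exact_mod_cast hsd
  have hlog : Real.log 2 ≤ sparseLog d s := Real.log_le_log (by norm_num) (by linarith)
  linarith [Real.log_two_gt_d9]

/-- The ratio of the squared height of the spikes to `log (1 + d / s²)` at which testing with error
less than `1 - ε` becomes impossible. -/
noncomputable def spikeScale (ε : ℝ) : ℝ :=
  min 1 (Real.log (1 + ε ^ 2) / 2)

lemma spikeScale_pos {ε : ℝ} (hε : 0 < ε) : 0 < spikeScale ε :=
  lt_min one_pos (half_pos (Real.log_pos (lt_add_of_pos_right _ (by positivity))))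

lemma spikeScale_nonneg (ε : ℝ) : 0 ≤ spikeScale ε :=
  le_min zero_le_one
    (div_nonneg (Real.log_nonneg (le_add_of_nonneg_right (sq_nonneg ε))) two_pos.le)

lemma spikeScale_le_one (ε : ℝ) : spikeScale ε ≤ 1 :=
  min_le_left _ _

lemma exp_two_mul_spikeScale_le (ε : ℝ) : Real.exp (2 * spikeScale ε) ≤ 1 + ε ^ 2 := by
  rw [← Real.le_log_iff_exp_le (by positivity)]
  linarith [min_le_right 1 (Real.log (1 + ε ^ 2) / 2), spikeScale.eq_1 ε]

lemma pow_sub_one_add_exp_le {d s b : ℕ} {a v : ℝ} (hs : 1 ≤ s) (hb : 1 ≤ b)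
    (hdb : d ≤ 2 * (s * b)) (ha0 : 0 ≤ a) (ha1 : a ≤ 1) (hv : v ≤ a * sparseLog d s) :
    ((b : ℝ) - 1 + Real.exp v) ^ s ≤ Real.exp (2 * a) * (b : ℝ) ^ s := by
  have hs0 : (0 : ℝ) < s := by exact_mod_cast hs
  have hb1 : (1 : ℝ) ≤ b := by exact_mod_cast hb
  have hratio : d / (s : ℝ) ^ 2 ≤ 2 * b / s := by
    rw [div_le_div_iff₀ (by positivity) hs0]
    nlinarith [show (d : ℝ) ≤ 2 * (s * b) by exact_mod_cast hdb]
  have hexp : Real.exp v ≤ 1 + 2 * a / s * b :=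
    calc Real.exp v ≤ Real.exp (sparseLog d s * a) := by rwa [Real.exp_le_exp, mul_comm]
      _ = (1 + d / (s : ℝ) ^ 2) ^ a := by rw [Real.exp_mul, exp_sparseLog]
      _ ≤ 1 + a * (d / (s : ℝ) ^ 2) :=
          rpow_one_add_le_one_add_mul_self
            (le_trans (by norm_num) (by positivity : (0 : ℝ) ≤ d / (s : ℝ) ^ 2)) ha0 ha1
      _ ≤ 1 + a * (2 * b / s) := by gcongr
      _ = 1 + 2 * a / s * b := by ring
  calc ((b : ℝ) - 1 + Real.exp v) ^ s ≤ (b * Real.exp (2 * a / s)) ^ s := by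
        refine pow_le_pow_left₀ (by linarith [Real.exp_pos v]) ?_ s
        nlinarith [Real.add_one_le_exp (2 * a / s)]
    _ = Real.exp (2 * a) * (b : ℝ) ^ s := by
        rw [mul_pow, ← Real.exp_nat_mul, mul_comm, mul_div_cancel₀ _ hs0.ne']

lemma exists_block_size {d s : ℕ} (hs : 1 ≤ s) (hsd : s ≤ d) :
    ∃ b, 1 ≤ b ∧ s * b ≤ d ∧ d ≤ 2 * (s * b) := by
  have hb : 1 ≤ d / s := (Nat.one_le_div_iff hs).2 hsd
  have hmod : s * (d / s) + d % s = d := Nat.div_add_mod d s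
  have hlt : d % s < s := Nat.mod_lt _ hs
  exact ⟨d / s, hb, Nat.mul_div_le d s, by nlinarith⟩

lemma le_minimaxRisk_of_flatVector_mem {d s : ℕ} {τ ε : ℝ} (hs : 1 ≤ s) (hsd : s ^ 2 ≤ d)
    (hε : 0 ≤ ε) (hτ : τ ^ 2 ≤ spikeScale ε * sparseLog d s) {Θ : Set (Fin d → ℝ)}
    (hΘ : ∀ S : Finset (Fin d), S.card = s → flatVector S τ ∈ Θ) :
    ENNReal.ofReal (1 - ε) ≤ minimaxRisk 1 Θ := by
  obtain ⟨b, hb, hsb, hdb⟩ := exists_block_size hs ((Nat.le_self_pow two_ne_zero s).trans hsd)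
  have : NeZero b := ⟨by omega⟩
  let e : Fin s × Fin b ↪ Fin d :=
    finProdFinEquiv.toEmbedding.trans (Fin.castLEEmb hsb)
  refine le_minimaxRisk_of_sum_exp_le hε (fun f : Fin s → Fin b => flatVector (blockSupport e f) τ)
    (fun f => hΘ _ (by rw [card_blockSupport, Fintype.card_fin])) ?_
  simp_rw [sum_flatVector_mul_flatVector, card_blockSupport_inter, sum_exp_mul_card_agree]
  simp only [Finset.sum_const, Finset.card_univ, Fintype.card_pi, Fintype.card_fin,
    Finset.prod_const, nsmul_eq_mul, Nat.cast_pow]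
  have hpow : ((b : ℝ) - 1 + Real.exp (τ ^ 2)) ^ s ≤ (1 + ε ^ 2) * (b : ℝ) ^ s :=
    (pow_sub_one_add_exp_le hs hb hdb (spikeScale_nonneg ε) (spikeScale_le_one ε) hτ).trans
      (mul_le_mul_of_nonneg_right (exp_two_mul_spikeScale_le ε) (by positivity))
  calc (b : ℝ) ^ s * ((b : ℝ) - 1 + Real.exp (τ ^ 2)) ^ s
      ≤ (b : ℝ) ^ s * ((1 + ε ^ 2) * (b : ℝ) ^ s) := by gcongr
    _ = (1 + ε ^ 2) * ((b : ℝ) ^ s) ^ 2 := by ring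

end SparseLowerBound

section ThresholdTests

lemma measure_abs_sub_integral_ge_le_of_variance_le {Ω : Type*} [MeasurableSpace Ω]
    {μ : Measure Ω} [IsFiniteMeasure μ] {X : Ω → ℝ} {c ρ : ℝ} (hX : MemLp X 2 μ) (hc : 0 < c)
    (hvar : Var[X; μ] ≤ ρ * c ^ 2) : μ {ω | c ≤ |X ω - ∫ ω, X ω ∂μ|} ≤ ENNReal.ofReal ρ :=
  (meas_ge_le_variance_div_sq hX hc).trans
    (ENNReal.ofReal_le_ofReal ((div_le_iff₀ (by positivity)).2 hvar))

instance {d : ℕ} (σ : ℝ) (θ : Fin d → ℝ) : IsProbabilityMeasure (obsLaw σ θ) :=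
  Measure.isProbabilityMeasure_map (Measurable.aemeasurable (by fun_prop))

/-- Chebyshev's inequality for the test that rejects when `T` exceeds its mean under `θ = 0` by more
than `H`. -/
lemma minimaxRisk_le_of_variance_le {d : ℕ} {σ H ρ₀ ρ₁ : ℝ} {Θ : Set (Fin d → ℝ)}
    {T : (Fin d → ℝ) → ℝ} (hT : Measurable T) (hTL : ∀ θ, MemLp T 2 (obsLaw σ θ)) (hH : 0 < H)
    (hvar₀ : Var[T; obsLaw σ 0] ≤ ρ₀ * H ^ 2)
    (hmean : ∀ θ ∈ Θ, H < ∫ y, T y ∂obsLaw σ θ - ∫ y, T y ∂obsLaw σ 0)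
    (hvar₁ : ∀ θ ∈ Θ, Var[T; obsLaw σ θ] ≤
      ρ₁ * (∫ y, T y ∂obsLaw σ θ - ∫ y, T y ∂obsLaw σ 0 - H) ^ 2) :
    minimaxRisk σ Θ ≤ ENNReal.ofReal ρ₀ + ENNReal.ofReal ρ₁ := by
  classical
  set E := ∫ y, T y ∂obsLaw σ 0
  let Δ : (Fin d → ℝ) → Fin 2 := fun y => if H < T y - E then 1 else 0
  have hΔ : Measurable Δ :=
    Measurable.ite (measurableSet_lt measurable_const (hT.sub_const E)) measurable_const
      measurable_const
  have hone : ∀ y, Δ y = 1 → H < T y - E := fun y hy => by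
    by_contra hlt
    simp [Δ, if_neg hlt] at hy
  have hzero : ∀ y, Δ y = 0 → T y - E ≤ H := fun y hy => by
    by_contra hlt
    simp [Δ, if_pos (not_le.1 hlt)] at hy
  refine (iInf₂_le Δ hΔ).trans (add_le_add ?_ (iSup₂_le fun θ hθ => ?_))
  · exact (measure_mono fun y hy => (hone y hy).le.trans (le_abs_self _)).trans
      (measure_abs_sub_integral_ge_le_of_variance_le (hTL 0) hH hvar₀)
  · refine (measure_mono fun y hy => ?_).trans (measure_abs_sub_integral_ge_le_of_variance_le
      (hTL θ) (sub_pos.2 (hmean θ hθ)) (hvar₁ θ hθ))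
    rw [Set.mem_ofPred_eq, abs_sub_comm]
    linarith [hzero y hy, le_abs_self (∫ y, T y ∂obsLaw σ θ - T y)]

section Additive

variable {ι Ω : Type*} [Fintype ι] [MeasurableSpace Ω] {μ : ι → Measure Ω}
  [∀ j, IsProbabilityMeasure (μ j)] {g : Ω → ℝ}

lemma memLp_sum_comp_eval (hg : ∀ j, MemLp g 2 (μ j)) :
    MemLp (fun y : ι → Ω => ∑ j, g (y j)) 2 (Measure.pi μ) :=
  memLp_finsetSum _ fun j _ => (hg j).comp_measurePreserving (measurePreserving_eval μ j)

lemma integral_sum_comp_eval (hg : ∀ j, Integrable g (μ j)) :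
    ∫ y : ι → Ω, ∑ j, g (y j) ∂Measure.pi μ = ∑ j, ∫ x, g x ∂μ j := by
  rw [integral_finsetSum _ fun j _ => integrable_comp_eval (hg j)]
  exact Finset.sum_congr rfl fun j _ => integral_comp_eval (hg j).1

lemma variance_sum_comp_eval (hg : ∀ j, MemLp g 2 (μ j)) :
    Var[fun y : ι → Ω => ∑ j, g (y j); Measure.pi μ] = ∑ j, Var[g; μ j] := by
  rw [← variance_sum_pi hg]
  congr 1 with y
  simp

end Additive

lemma mul_sq_add_le_three_mul_sq {a D n : ℝ} (ha : 1 ≤ a) (hD : 1 / 2 ≤ D) (hn : a * D ≤ n) :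
    a * (D ^ 2 + n) ≤ 3 * n ^ 2 := by
  have hsq : a * D ^ 2 ≤ n ^ 2 :=
    calc a * D ^ 2 ≤ a ^ 2 * D ^ 2 := by gcongr; exact le_self_pow₀ ha two_ne_zero
      _ = (a * D) ^ 2 := by ring
      _ ≤ n ^ 2 := by gcongr
  have hlin : a * n ≤ 2 * n ^ 2 := by
    have hn0 : 0 ≤ n := le_trans (by positivity) hn
    nlinarith [mul_le_mul_of_nonneg_right (show a ≤ 2 * n by nlinarith) hn0]
  linarith

lemma minimaxRisk_le_of_additive {d : ℕ} {A C D : ℝ} (hA : 1 ≤ A) (hC : 0 ≤ C) (hD : 1 / 2 ≤ D)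
    {g : ℝ → ℝ} (hg : Measurable g) (hgL : ∀ h, MemLp g 2 (gaussianReal h 1))
    (hvar : ∀ h : Fin d → ℝ, ∑ j, Var[g; gaussianReal (h j) 1] ≤ C * (D ^ 2 + ∑ j, h j ^ 2))
    {Θ : Set (Fin d → ℝ)} (hsep : ∀ θ ∈ Θ, A ^ 2 * D ≤ ∑ j, θ j ^ 2)
    (hmean : ∀ θ ∈ Θ, (∑ j, θ j ^ 2) / 16 ≤
      ∑ j, (∫ x, g x ∂gaussianReal (θ j) 1 - ∫ x, g x ∂gaussianReal 0 1)) :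
    minimaxRisk 1 Θ ≤ ENNReal.ofReal (4096 * C / A ^ 2) := by
  have hA2 : 1 ≤ A ^ 2 := one_le_pow₀ hA
  have hH : 0 < A ^ 2 * D / 32 := by positivity
  have hmean' : ∀ θ ∈ Θ, (∑ j, θ j ^ 2) / 16 ≤
      ∑ j, ∫ x, g x ∂gaussianReal (θ j) 1 - ∑ _j : Fin d, ∫ x, g x ∂gaussianReal 0 1 :=
    fun θ hθ => (hmean θ hθ).trans_eq (Finset.sum_sub_distrib ..)
  have hrisk : minimaxRisk 1 Θ ≤
      ENNReal.ofReal (1024 * C / A ^ 2) + ENNReal.ofReal (3072 * C / A ^ 2) := by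
    refine minimaxRisk_le_of_variance_le (T := fun y => ∑ j, g (y j)) (H := A ^ 2 * D / 32)
      (by fun_prop) (fun θ => ?_) hH ?_ (fun θ hθ => ?_) (fun θ hθ => ?_) <;>
      simp only [obsLaw_one, variance_sum_comp_eval fun _ => hgL _,
        integral_sum_comp_eval fun _ => (hgL _).integrable one_le_two, Pi.zero_apply]
    · exact memLp_sum_comp_eval fun _ => hgL _
    · calc ∑ _j : Fin d, Var[g; gaussianReal 0 1] ≤ C * D ^ 2 := by
            simpa using hvar 0
        _ ≤ A ^ 2 * (C * D ^ 2) := le_mul_of_one_le_left (by positivity) hA2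
        _ = 1024 * C / A ^ 2 * (A ^ 2 * D / 32) ^ 2 := by field_simp; norm_num
    · refine lt_of_lt_of_le ?_ (hmean' θ hθ)
      linarith [hsep θ hθ]
    · set n := ∑ j, θ j ^ 2
      have hn := hsep θ hθ
      have hn0 : 0 ≤ n := le_trans (by positivity) hn
      calc ∑ j, Var[g; gaussianReal (θ j) 1] ≤ C * (D ^ 2 + n) := hvar θ
        _ = C / A ^ 2 * (A ^ 2 * (D ^ 2 + n)) := by field_simp
        _ ≤ C / A ^ 2 * (3 * n ^ 2) :=
          mul_le_mul_of_nonneg_left (mul_sq_add_le_three_mul_sq hA2 hD hn) (by positivity)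
        _ = 3072 * C / A ^ 2 * (n / 32) ^ 2 := by ring
        _ ≤ _ := by
          gcongr
          linarith [hmean' θ hθ]
  refine hrisk.trans_eq ?_
  rw [← ENNReal.ofReal_add (by positivity) (by positivity)]
  ring_nf

end ThresholdTests

section GaussianMoments

lemma gaussianReal_eq_map_add (h : ℝ) (v : NNReal) :
    gaussianReal h v = (gaussianReal 0 v).map (h + ·) := by
  rw [gaussianReal_map_const_add, zero_add]

lemma integral_sq_gaussianReal (h : ℝ) (v : NNReal) :
    ∫ x, x ^ 2 ∂gaussianReal h v = h ^ 2 + v := by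
  have hvar := variance_eq_sub (memLp_id_gaussianReal (μ := h) (v := v) 2)
  simp only [variance_id_gaussianReal, Pi.pow_apply, id_eq, integral_id_gaussianReal] at hvar
  linarith

lemma memLp_sq_gaussianReal (h : ℝ) (v : NNReal) : MemLp (fun x => x ^ 2) 2 (gaussianReal h v) := by
  rw [memLp_two_iff_integrable_sq (by fun_prop)]
  simpa [← pow_mul, (show Even 4 by decide).pow_abs] using
    (memLp_id_gaussianReal (μ := h) (v := v) 4).integrable_norm_pow

lemma integrable_pow_four_mul_exp_sq_div_four :
    Integrable (fun x : ℝ => x ^ 4 * Real.exp (x ^ 2 / 4)) (gaussianReal 0 1) := by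
  rw [gaussianReal_of_var_ne_zero 0 one_ne_zero,
    integrable_withDensity_iff_integrable_smul' (measurable_gaussianPDF 0 1)
      (ae_of_all _ fun _ => gaussianPDF_lt_top)]
  have h := (integrable_rpow_mul_exp_neg_mul_sq (b := 1 / 4) (by norm_num) (s := (4 : ℕ))
    (by norm_num)).const_mul (√(2 * Real.pi * 1))⁻¹
  refine h.congr (ae_of_all _ fun x => ?_)
  simp only [toReal_gaussianPDF, gaussianPDFReal, smul_eq_mul, NNReal.coe_one, sub_zero, mul_one]
  rw [Real.rpow_natCast, mul_assoc, mul_left_comm (Real.exp _), ← Real.exp_add]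
  ring_nf

/-- The moment `𝔼[ξ⁴ exp(ξ²/4)]` of a standard normal `ξ`. It bounds both `𝔼[ξ⁴]` and the truncated
moments `exp(u²/4) 𝔼[ξ⁴; |ξ| ≥ u]`. -/
noncomputable def gaussMoment : ℝ := ∫ x, x ^ 4 * Real.exp (x ^ 2 / 4) ∂gaussianReal 0 1

lemma gaussMoment_nonneg : 0 ≤ gaussMoment :=
  integral_nonneg fun _ => by positivity

lemma pow_four_le_pow_four_mul_exp (x : ℝ) : x ^ 4 ≤ x ^ 4 * Real.exp (x ^ 2 / 4) :=
  le_mul_of_one_le_right (by positivity) (Real.one_le_exp (by positivity))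

lemma integrable_pow_four_gaussianReal : Integrable (fun x : ℝ => x ^ 4) (gaussianReal 0 1) := by
  simpa [← pow_mul] using (memLp_sq_gaussianReal 0 1).integrable_sq

lemma integral_pow_four_le_gaussMoment : ∫ x, x ^ 4 ∂gaussianReal 0 1 ≤ gaussMoment :=
  integral_mono integrable_pow_four_gaussianReal integrable_pow_four_mul_exp_sq_div_four
    pow_four_le_pow_four_mul_exp

lemma integral_gaussianReal_zero_le_of_convexOn_of_even {f : ℝ → ℝ} (hf : ConvexOn ℝ Set.univ f)
    (heven : ∀ x, f (-x) = f x) {v : NNReal} (hint : ∀ h, Integrable f (gaussianReal h v)) (h : ℝ) :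
    ∫ x, f x ∂gaussianReal 0 v ≤ ∫ x, f x ∂gaussianReal h v := by
  have hshift (a : ℝ) : Integrable (fun x => f (a + x)) (gaussianReal 0 v) :=
    (gaussianReal_eq_map_add a v ▸ hint a).comp_measurable (measurable_const_add a)
  have hmean (a : ℝ) : ∫ x, f (a + x) ∂gaussianReal 0 v = ∫ x, f x ∂gaussianReal a v := by
    rw [gaussianReal_eq_map_add a v]
    exact ((MeasurableEquiv.addLeft a).measurableEmbedding.integral_map f).symm
  have hneg : ∫ x, f x ∂gaussianReal (-h) v = ∫ x, f x ∂gaussianReal h v := by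
    rw [← gaussianReal_map_neg]
    exact ((MeasurableEquiv.neg ℝ).measurableEmbedding.integral_map f).trans
      (integral_congr_ae (ae_of_all _ heven))
  have hmid (x : ℝ) : f x ≤ (f (h + x) + f (-h + x)) / 2 := by
    have := hf.2 (Set.mem_univ (h + x)) (Set.mem_univ (-h + x))
      one_half_pos.le one_half_pos.le (add_halves 1)
    simp only [smul_eq_mul] at this
    ring_nf at this ⊢
    linarith
  calc ∫ x, f x ∂gaussianReal 0 v
      ≤ ∫ x, (f (h + x) + f (-h + x)) / 2 ∂gaussianReal 0 v :=
        integral_mono (hint 0) (((hshift h).add (hshift (-h))).div_const 2) hmid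
    _ = ∫ x, f x ∂gaussianReal h v := by
        rw [integral_div, integral_add (hshift h) (hshift (-h)), hmean, hmean, hneg]
        ring

lemma le_integral_gaussianReal_of_convexOn {f : ℝ → ℝ} (hf : ConvexOn ℝ Set.univ f) {h : ℝ}
    {v : NNReal} (hint : Integrable f (gaussianReal h v)) : f h ≤ ∫ x, f x ∂gaussianReal h v := by
  have := hf.map_integral_le (hf.continuousOn isOpen_univ) isClosed_univ
    (ae_of_all _ Set.mem_univ) ((memLp_id_gaussianReal 1).integrable le_rfl) hint
  simpa using this

end GaussianMoments

section ThresholdedSquare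

/-- The thresholded square `(|y| - t)_+²`, the summand of the test statistics. -/
def sqExcess (t y : ℝ) : ℝ := max (|y| - t) 0 ^ 2

@[fun_prop]
lemma continuous_sqExcess (t : ℝ) : Continuous (sqExcess t) := by
  unfold sqExcess
  fun_prop

lemma sqExcess_nonneg (t y : ℝ) : 0 ≤ sqExcess t y := sq_nonneg _

lemma sqExcess_neg (t y : ℝ) : sqExcess t (-y) = sqExcess t y := by
  simp [sqExcess]

lemma sqExcess_le_sq {t : ℝ} (ht : 0 ≤ t) (y : ℝ) : sqExcess t y ≤ y ^ 2 := by
  rw [← sq_abs y]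
  exact pow_le_pow_left₀ (le_max_right _ _) (max_le (by linarith) (abs_nonneg y)) 2

lemma convexOn_sqExcess (t : ℝ) : ConvexOn ℝ Set.univ (sqExcess t) :=
  (((convexOn_univ_norm (E := ℝ)).add_const (-t)).sup (convexOn_const 0 convex_univ)).pow
    (fun _ _ => le_max_right _ _) 2

lemma sq_sqExcess_add_sub_le (t h x : ℝ) :
    (sqExcess t (h + x) - sqExcess t h) ^ 2 ≤ 4 * (x ^ 2 * sqExcess t (|h| + |x|)) := by
  unfold sqExcess
  rw [abs_of_nonneg (by positivity : 0 ≤ |h| + |x|)]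
  set w := max (|h| + |x| - t) 0
  set u := max (|h + x| - t) 0
  set v := max (|h| - t) 0
  have huw : u ≤ w := max_le_max (by linarith [abs_add_le h x]) le_rfl
  have hvw : v ≤ w := max_le_max (by linarith [abs_nonneg x]) le_rfl
  have hsub : |u - v| ≤ |x| :=
    calc |u - v| ≤ |(|h + x| - t) - (|h| - t)| := abs_max_sub_max_le_abs _ _ _
      _ = |(|h + x| - |h|)| := by rw [sub_sub_sub_cancel_right]
      _ ≤ |x| := by simpa using abs_abs_sub_abs_le (h + x) h
  have hadd : |u + v| ≤ 2 * w := by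
    rw [abs_of_nonneg (add_nonneg (le_max_right _ _) (le_max_right _ _))]
    linarith
  calc (u ^ 2 - v ^ 2) ^ 2 = |u - v| ^ 2 * |u + v| ^ 2 := by rw [sq_abs, sq_abs]; ring
    _ ≤ |x| ^ 2 * (2 * w) ^ 2 := by gcongr
    _ = 4 * (x ^ 2 * w ^ 2) := by rw [sq_abs]; ring

lemma memLp_sqExcess {t : ℝ} (ht : 0 ≤ t) (h : ℝ) (v : NNReal) :
    MemLp (sqExcess t) 2 (gaussianReal h v) :=
  (memLp_sq_gaussianReal h v).mono' (by fun_prop) <| ae_of_all _ fun x => by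
    rw [Real.norm_of_nonneg (sqExcess_nonneg t x)]
    exact sqExcess_le_sq ht x

lemma integrable_sqExcess {t : ℝ} (ht : 0 ≤ t) (h : ℝ) (v : NNReal) :
    Integrable (sqExcess t) (gaussianReal h v) :=
  (memLp_sqExcess ht h v).integrable one_le_two

lemma variance_sqExcess_le_of_forall_le {t h : ℝ} (ht : 0 ≤ t) {v : NNReal} {f : ℝ → ℝ}
    (hf : Integrable f (gaussianReal 0 v)) (hle : ∀ x, x ^ 2 * sqExcess t (|h| + |x|) ≤ f x) :
    Var[sqExcess t; gaussianReal h v] ≤ 4 * ∫ x, f x ∂gaussianReal 0 v := by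
  have hshift : MemLp (fun x => sqExcess t (h + x)) 2 (gaussianReal 0 v) :=
    (memLp_sqExcess ht h v).comp_measurePreserving
      ⟨measurable_const_add h, (gaussianReal_eq_map_add h v).symm⟩
  calc Var[sqExcess t; gaussianReal h v]
      = Var[fun x => sqExcess t (h + x); gaussianReal 0 v] := by
        rw [gaussianReal_eq_map_add h v, variance_map (by fun_prop) (by fun_prop)]
        rfl
    _ = Var[fun x => sqExcess t (h + x) - sqExcess t h; gaussianReal 0 v] :=
        (variance_sub_const hshift.1 _).symm
    _ ≤ ∫ x, (sqExcess t (h + x) - sqExcess t h) ^ 2 ∂gaussianReal 0 v :=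
        variance_le_expectation_sq (by fun_prop)
    _ ≤ ∫ x, 4 * f x ∂gaussianReal 0 v :=
        integral_mono (hshift.sub (memLp_const _)).integrable_sq (hf.const_mul 4) fun x =>
          (sq_sqExcess_add_sub_le t h x).trans (mul_le_mul_of_nonneg_left (hle x) (by norm_num))
    _ = 4 * ∫ x, f x ∂gaussianReal 0 v := integral_const_mul _ _

lemma variance_sqExcess_le {t : ℝ} (ht : 0 ≤ t) (h : ℝ) :
    Var[sqExcess t; gaussianReal h 1] ≤ 8 * h ^ 2 + 8 * gaussMoment := by
  have hsq : Integrable (fun x : ℝ => 2 * h ^ 2 * x ^ 2) (gaussianReal 0 1) :=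
    ((memLp_sq_gaussianReal 0 1).integrable one_le_two).const_mul _
  have hfour := integrable_pow_four_gaussianReal.const_mul 2
  have hle (x : ℝ) : x ^ 2 * sqExcess t (|h| + |x|) ≤ 2 * h ^ 2 * x ^ 2 + 2 * x ^ 4 :=
    calc x ^ 2 * sqExcess t (|h| + |x|) ≤ x ^ 2 * (2 * (|h| ^ 2 + |x| ^ 2)) := by
          gcongr
          exact (sqExcess_le_sq ht _).trans (add_sq_le ..)
      _ = 2 * h ^ 2 * x ^ 2 + 2 * x ^ 4 := by rw [sq_abs, sq_abs]; ring
  have hvar := variance_sqExcess_le_of_forall_le ht (hsq.add hfour) hle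
  simp only [Pi.add_apply] at hvar
  rw [integral_add hsq hfour, integral_const_mul, integral_const_mul,
    integral_sq_gaussianReal] at hvar
  norm_num at hvar
  linarith [integral_pow_four_le_gaussMoment]

lemma sq_mul_sqExcess_le_of_abs_le {t h : ℝ} (ht : 0 ≤ t) (hh : |h| ≤ t / 2) (x : ℝ) :
    x ^ 2 * sqExcess t (|h| + |x|) ≤
      x ^ 4 * Real.exp (x ^ 2 / 4) * Real.exp (-(t ^ 2 / 16)) := by
  rw [sqExcess, abs_of_nonneg (by positivity : 0 ≤ |h| + |x|)]
  rcases le_total (|h| + |x|) t with hx | hx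
  · rw [max_eq_right (by linarith)]
    simp only [ne_eq, OfNat.ofNat_ne_zero, not_false_eq_true, zero_pow, mul_zero]
    positivity
  · have hexp : 1 ≤ Real.exp (x ^ 2 / 4 + -(t ^ 2 / 16)) := by
      have : (t / 2) ^ 2 ≤ |x| ^ 2 := by gcongr; linarith
      rw [sq_abs] at this
      exact Real.one_le_exp (by linarith)
    calc x ^ 2 * max (|h| + |x| - t) 0 ^ 2 ≤ x ^ 2 * |x| ^ 2 := by
          gcongr
          exact max_le (by linarith [abs_nonneg x]) (abs_nonneg x)
      _ = x ^ 4 := by rw [sq_abs]; ring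
      _ ≤ x ^ 4 * Real.exp (x ^ 2 / 4 + -(t ^ 2 / 16)) :=
        le_mul_of_one_le_right (by positivity) hexp
      _ = _ := by rw [Real.exp_add, mul_assoc]

lemma variance_sqExcess_le_of_abs_le {t h : ℝ} (ht : 0 ≤ t) (hh : |h| ≤ t / 2) :
    Var[sqExcess t; gaussianReal h 1] ≤ 4 * (gaussMoment * Real.exp (-(t ^ 2 / 16))) := by
  have := variance_sqExcess_le_of_forall_le ht
    (integrable_pow_four_mul_exp_sq_div_four.mul_const (Real.exp (-(t ^ 2 / 16))))
    (sq_mul_sqExcess_le_of_abs_le ht hh)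
  rwa [integral_mul_const] at this

lemma variance_sqExcess_le_exp_add_sq {t : ℝ} (ht : 0 ≤ t) (ht2 : 8 ≤ t ^ 2) (h : ℝ) :
    Var[sqExcess t; gaussianReal h 1] ≤
      4 * (gaussMoment * Real.exp (-(t ^ 2 / 16))) + (8 + 4 * gaussMoment) * h ^ 2 := by
  have hM := gaussMoment_nonneg
  have hexp : 0 ≤ gaussMoment * Real.exp (-(t ^ 2 / 16)) := by positivity
  rcases le_or_gt |h| (t / 2) with hh | hh
  · have hsq : 0 ≤ (8 + 4 * gaussMoment) * h ^ 2 := by positivity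
    linarith [variance_sqExcess_le_of_abs_le ht hh]
  · have htwo : 2 ≤ h ^ 2 := by
      have : (t / 2) ^ 2 ≤ |h| ^ 2 := by gcongr
      rw [sq_abs] at this
      linarith
    nlinarith [variance_sqExcess_le ht h]

lemma integral_sqExcess_zero_le {t : ℝ} (ht : 0 ≤ t) (h : ℝ) (v : NNReal) :
    ∫ x, sqExcess t x ∂gaussianReal 0 v ≤ ∫ x, sqExcess t x ∂gaussianReal h v :=
  integral_gaussianReal_zero_le_of_convexOn_of_even (convexOn_sqExcess t) (sqExcess_neg t)
    (fun h => integrable_sqExcess ht h v) h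

lemma sq_div_eight_le_integral_sqExcess_sub {t h : ℝ} (ht : 0 ≤ t) (ht2 : 8 ≤ t ^ 2)
    (hh : 2 * t < |h|) :
    h ^ 2 / 8 ≤ ∫ x, sqExcess t x ∂gaussianReal h 1 - ∫ x, sqExcess t x ∂gaussianReal 0 1 := by
  have hnull : ∫ x, sqExcess t x ∂gaussianReal 0 1 ≤ 1 :=
    calc ∫ x, sqExcess t x ∂gaussianReal 0 1 ≤ ∫ x, x ^ 2 ∂gaussianReal 0 1 :=
          integral_mono (integrable_sqExcess ht 0 1)
            ((memLp_sq_gaussianReal 0 1).integrable one_le_two) (sqExcess_le_sq ht)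
      _ = 1 := by simp [integral_sq_gaussianReal]
  have hjensen : sqExcess t h ≤ ∫ x, sqExcess t x ∂gaussianReal h 1 :=
    le_integral_gaussianReal_of_convexOn (convexOn_sqExcess t) (integrable_sqExcess ht h 1)
  have hquarter : h ^ 2 / 4 ≤ sqExcess t h := by
    rw [sqExcess, max_eq_left (by linarith), ← sq_abs h]
    nlinarith
  have hh_sq : 8 ≤ h ^ 2 := by
    rw [← sq_abs h]
    nlinarith
  linarith

end ThresholdedSquare

section UpperBounds

/-- The constant in the variance bounds `∑ⱼ Var ≤ varConst * (D² + ‖h‖₂²)` for the test statistics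
of both zones. -/
noncomputable def varConst : ℝ := 16 * gaussMoment + 8

lemma varConst_pos : 0 < varConst := by
  have := gaussMoment_nonneg
  unfold varConst
  positivity

/-- The constant `A_ε` of the upper bounds: multiples of the rate beyond `upperScale ε` are detected
with risk at most `ε`. -/
noncomputable def upperScale (ε : ℝ) : ℝ := 16 + 4096 * varConst / ε

lemma sixteen_lt_upperScale {ε : ℝ} (hε : 0 < ε) : 16 < upperScale ε :=
  lt_add_of_pos_right _ <| div_pos (mul_pos (by norm_num) varConst_pos) hε

lemma upperScale_pos {ε : ℝ} (hε : 0 < ε) : 0 < upperScale ε :=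
  (by norm_num : (0 : ℝ) < 16).trans (sixteen_lt_upperScale hε)

lemma ofReal_varConst_div_le {A ε : ℝ} (hε : 0 < ε) (hA : upperScale ε < A) :
    ENNReal.ofReal (4096 * varConst / A ^ 2) ≤ ENNReal.ofReal ε := by
  have hC : 0 < 4096 * varConst / ε := by have := varConst_pos; positivity
  unfold upperScale at hA
  refine ENNReal.ofReal_le_ofReal ?_
  rw [div_le_comm₀ (by nlinarith) hε]
  nlinarith

lemma minimaxRisk_le_of_sqrt_le {d : ℕ} {A : ℝ} (hd : 1 ≤ d) (hA : 1 ≤ A) {Θ : Set (Fin d → ℝ)}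
    (hΘ : ∀ θ ∈ Θ, A ^ 2 * √d ≤ ∑ j, θ j ^ 2) :
    minimaxRisk 1 Θ ≤ ENNReal.ofReal (4096 * varConst / A ^ 2) := by
  have hd1 : (1 : ℝ) ≤ √d := Real.one_le_sqrt.2 (by exact_mod_cast hd)
  have hsq : sqExcess 0 = fun x => x ^ 2 := by ext; simp [sqExcess]
  refine minimaxRisk_le_of_additive hA varConst_pos.le (D := √d) (by linarith)
    (continuous_sqExcess 0).measurable (fun h => memLp_sqExcess le_rfl h 1) (fun h => ?_) hΘ
    fun θ _ => ?_
  · have hM := gaussMoment_nonneg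
    have hn : 0 ≤ ∑ j, h j ^ 2 := by positivity
    calc ∑ j, Var[sqExcess 0; gaussianReal (h j) 1]
        ≤ ∑ j, (8 * h j ^ 2 + 8 * gaussMoment) :=
          Finset.sum_le_sum fun j _ => variance_sqExcess_le le_rfl (h j)
      _ = 8 * ∑ j, h j ^ 2 + 8 * gaussMoment * d := by
          simp [Finset.sum_add_distrib, Finset.mul_sum, mul_comm]
      _ ≤ varConst * (√d ^ 2 + ∑ j, h j ^ 2) := by
          rw [Real.sq_sqrt (by positivity), varConst]
          nlinarith [mul_nonneg hM hn, mul_nonneg hM (Nat.cast_nonneg (α := ℝ) d),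
            Nat.cast_nonneg (α := ℝ) d]
  · have hn : 0 ≤ ∑ j, θ j ^ 2 := by positivity
    simp only [hsq, integral_sq_gaussianReal]
    simp only [ne_eq, OfNat.ofNat_ne_zero, not_false_eq_true, zero_pow, add_sub_add_right_eq_sub,
      sub_zero]
    linarith

lemma mul_exp_neg_sparseLog_le {d s : ℕ} (hs : 1 ≤ s) :
    d * Real.exp (-sparseLog d s) ≤ (s : ℝ) ^ 2 := by
  have hs0 : (0 : ℝ) < s ^ 2 := by positivity
  rw [Real.exp_neg, exp_sparseLog, mul_inv_le_iff₀ (by positivity), mul_add, mul_one,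
    mul_div_cancel₀ _ hs0.ne']
  linarith

lemma sum_variance_sqExcess_le_of_sparse {d s : ℕ} (hs : 1 ≤ s) (hsd : s ^ 2 ≤ d)
    (h : Fin d → ℝ) :
    ∑ j, Var[sqExcess (4 * √(sparseLog d s)); gaussianReal (h j) 1] ≤
      varConst * ((s * sparseLog d s) ^ 2 + ∑ j, h j ^ 2) := by
  set L := sparseLog d s
  have hL : 1 / 2 ≤ L := half_le_sparseLog hs hsd
  have hM := gaussMoment_nonneg
  have ht2 : (4 * √L) ^ 2 = 16 * L := by
    rw [mul_pow, Real.sq_sqrt (by linarith)]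
    norm_num
  have hvar (x : ℝ) : Var[sqExcess (4 * √L); gaussianReal x 1] ≤
      4 * (gaussMoment * Real.exp (-L)) + (8 + 4 * gaussMoment) * x ^ 2 := by
    have hexp : (4 * √L) ^ 2 / 16 = L := by linarith
    have := variance_sqExcess_le_exp_add_sq (t := 4 * √L) (by positivity) (by linarith) x
    rwa [hexp] at this
  have hn : 0 ≤ ∑ j, h j ^ 2 := by positivity
  have hsL : (s : ℝ) ^ 2 ≤ 4 * (s * L) ^ 2 := by
    have : 1 ≤ 4 * L ^ 2 := by nlinarith
    nlinarith [sq_nonneg (s : ℝ)]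
  calc ∑ j, Var[sqExcess (4 * √L); gaussianReal (h j) 1]
      ≤ ∑ j, (4 * (gaussMoment * Real.exp (-L)) + (8 + 4 * gaussMoment) * h j ^ 2) :=
        Finset.sum_le_sum fun j _ => hvar (h j)
    _ = 4 * gaussMoment * (d * Real.exp (-L)) + (8 + 4 * gaussMoment) * ∑ j, h j ^ 2 := by
        rw [Finset.sum_add_distrib, ← Finset.mul_sum _ _ (8 + 4 * gaussMoment)]
        simp only [Finset.sum_const, Finset.card_univ, Fintype.card_fin, nsmul_eq_mul]
        ring
    _ ≤ 4 * gaussMoment * (4 * (s * L) ^ 2) + (8 + 4 * gaussMoment) * ∑ j, h j ^ 2 := by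
        have := (mul_exp_neg_sparseLog_le (d := d) hs).trans hsL
        gcongr
    _ ≤ varConst * ((s * L) ^ 2 + ∑ j, h j ^ 2) := by
        rw [varConst]
        nlinarith [mul_nonneg hM hn, sq_nonneg (s * L)]

lemma minimaxRisk_le_of_mul_sparseLog_le {d s : ℕ} {A : ℝ} (hs : 1 ≤ s) (hsd : s ^ 2 ≤ d)
    (hA : 16 ≤ A) {Θ : Set (Fin d → ℝ)}
    (hsep : ∀ θ ∈ Θ, A ^ 2 * (s * sparseLog d s) ≤ ∑ j, θ j ^ 2)
    (hsmall : ∀ θ ∈ Θ,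
      ∑ j with |θ j| ≤ 8 * √(sparseLog d s), θ j ^ 2 ≤ 128 * (s * sparseLog d s)) :
    minimaxRisk 1 Θ ≤ ENNReal.ofReal (4096 * varConst / A ^ 2) := by
  set L := sparseLog d s
  have hL : 1 / 2 ≤ L := half_le_sparseLog hs hsd
  have hs1 : (1 : ℝ) ≤ s := by exact_mod_cast hs
  have ht : 0 ≤ 4 * √L := by positivity
  have ht2 : 8 ≤ (4 * √L) ^ 2 := by
    rw [mul_pow, Real.sq_sqrt (by linarith)]
    linarith
  refine minimaxRisk_le_of_additive (by linarith) varConst_pos.le (D := s * L) (by nlinarith)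
    (continuous_sqExcess _).measurable (fun h => memLp_sqExcess ht h 1)
    (sum_variance_sqExcess_le_of_sparse hs hsd) hsep fun θ hθ => ?_
  have hlarge : ∑ j with ¬ |θ j| ≤ 8 * √L, θ j ^ 2 / 8 ≤
      ∑ j, (∫ x, sqExcess (4 * √L) x ∂gaussianReal (θ j) 1 -
        ∫ x, sqExcess (4 * √L) x ∂gaussianReal 0 1) := by
    refine (Finset.sum_le_sum fun j hj => ?_).trans <| Finset.sum_le_sum_of_subset_of_nonneg
      (Finset.filter_subset _ _) fun j _ _ => sub_nonneg.2 (integral_sqExcess_zero_le ht (θ j) 1)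
    rw [Finset.mem_filter_univ] at hj
    exact sq_div_eight_le_integral_sqExcess_sub ht ht2 (by linarith)
  rw [← Finset.sum_div] at hlarge
  have hsplit := Finset.sum_filter_add_sum_filter_not Finset.univ (fun j => |θ j| ≤ 8 * √L)
    fun j => θ j ^ 2
  have hA2 : 256 * (s * L) ≤ A ^ 2 * (s * L) := by
    gcongr
    nlinarith
  linarith [hsep θ hθ, hsmall θ hθ]

end UpperBounds

section Norms

variable {d : ℕ}

lemma l2_sq (θ : Fin d → ℝ) : l2 θ ^ 2 = ∑ j, θ j ^ 2 :=
  Real.sq_sqrt (by positivity)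

lemma sum_sq_le_of_l0_le {s : ℕ} {c : ℝ} {θ : Fin d → ℝ} (h : l0 θ ≤ s) :
    ∑ j with |θ j| ≤ c, θ j ^ 2 ≤ s * c ^ 2 := by
  have hcard : Finset.card {j | θ j ≠ 0} ≤ s := by
    simpa [l0, Set.ncard_eq_toFinset_card'] using h
  calc ∑ j with |θ j| ≤ c, θ j ^ 2 = ∑ j with |θ j| ≤ c ∧ θ j ≠ 0, θ j ^ 2 := by
        rw [← Finset.filter_filter]
        exact (Finset.sum_filter_of_ne fun j _ hj => (pow_ne_zero_iff two_ne_zero).1 hj).symm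
    _ ≤ ∑ j with |θ j| ≤ c ∧ θ j ≠ 0, c ^ 2 := by
        refine Finset.sum_le_sum fun j hj => ?_
        rw [← sq_abs (θ j)]
        gcongr
        exact (Finset.mem_filter.1 hj).2.1
    _ ≤ s * c ^ 2 := by
        rw [Finset.sum_const, nsmul_eq_mul]
        gcongr
        exact (Finset.card_le_card fun j hj => by simp_all).trans hcard

lemma sum_abs_rpow_le_of_lq_le {q r : ℝ} (hq : 0 < q) {θ : Fin d → ℝ} (h : lq q θ ≤ r) :
    ∑ j, |θ j| ^ q ≤ r ^ q := by
  have h0 : 0 ≤ ∑ j, |θ j| ^ q := by positivity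
  have := Real.rpow_le_rpow (by unfold lq; positivity) h hq.le
  rwa [lq, ← Real.rpow_mul h0, one_div_mul_cancel hq.ne', Real.rpow_one] at this

lemma sq_le_rpow_mul_rpow {q c x : ℝ} (hq : 0 < q) (hq2 : q ≤ 2) (hx : |x| ≤ c) :
    x ^ 2 ≤ c ^ (2 - q) * |x| ^ q :=
  calc x ^ 2 = |x| ^ ((2 - q) + q) := by
        rw [sub_add_cancel, Real.rpow_two, sq_abs]
    _ = |x| ^ (2 - q) * |x| ^ q :=
        Real.rpow_add_of_nonneg (abs_nonneg x) (by linarith) hq.le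
    _ ≤ c ^ (2 - q) * |x| ^ q := by
        gcongr

lemma sum_sq_le_of_lq_le {q r c : ℝ} (hq : 0 < q) (hq2 : q ≤ 2) (hc : 0 ≤ c) {θ : Fin d → ℝ}
    (h : lq q θ ≤ r) : ∑ j with |θ j| ≤ c, θ j ^ 2 ≤ c ^ (2 - q) * r ^ q :=
  calc ∑ j with |θ j| ≤ c, θ j ^ 2 ≤ ∑ j with |θ j| ≤ c, c ^ (2 - q) * |θ j| ^ q :=
        Finset.sum_le_sum fun j hj => sq_le_rpow_mul_rpow hq hq2 (Finset.mem_filter.1 hj).2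
    _ ≤ ∑ j, c ^ (2 - q) * |θ j| ^ q :=
        Finset.sum_le_sum_of_subset_of_nonneg (Finset.filter_subset _ _) fun _ _ _ => by positivity
    _ ≤ c ^ (2 - q) * r ^ q := by
        rw [← Finset.mul_sum]
        gcongr
        exact sum_abs_rpow_le_of_lq_le hq h

lemma l2_le_of_lq_le {q r : ℝ} (hq : 0 < q) (hq2 : q ≤ 2) (hr : 0 ≤ r) {θ : Fin d → ℝ}
    (h : lq q θ ≤ r) : l2 θ ≤ r := by
  have hcoord (j : Fin d) : |θ j| ≤ r := by
    have hsingle : |θ j| ^ q ≤ ∑ i, |θ i| ^ q :=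
      Finset.single_le_sum (f := fun i => |θ i| ^ q) (fun _ _ => by positivity) (Finset.mem_univ j)
    exact (Real.rpow_le_rpow_iff (abs_nonneg _) hr hq).1
      (hsingle.trans (sum_abs_rpow_le_of_lq_le hq h))
  have hsum := sum_sq_le_of_lq_le hq hq2 hr h
  rw [Finset.filter_true_of_mem fun j _ => hcoord j,
    ← Real.rpow_add_of_nonneg hr (by linarith) hq.le, sub_add_cancel, Real.rpow_two] at hsum
  exact Real.sqrt_le_iff.2 ⟨hr, hsum⟩

lemma l0_flatVector_le (S : Finset (Fin d)) (τ : ℝ) : l0 (flatVector S τ) ≤ S.card := by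
  rw [← Set.ncard_coe_finset, l0]
  refine Set.ncard_le_ncard (fun j hj => ?_) S.finite_toSet
  by_contra hjS
  simp_all [flatVector]

lemma lq_flatVector {q τ : ℝ} (hq : 0 < q) (hτ : 0 ≤ τ) (S : Finset (Fin d)) :
    lq q (flatVector S τ) = (S.card : ℝ) ^ (1 / q) * τ := by
  have hsum : ∑ j, |flatVector S τ j| ^ q = S.card * τ ^ q := by
    have hterm (j : Fin d) : |flatVector S τ j| ^ q = if j ∈ S then τ ^ q else 0 := by
      unfold flatVector
      split_ifs <;> simp [hq.ne', abs_of_nonneg hτ]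
    simp [hterm]
  rw [lq, hsum, Real.mul_rpow (by positivity) (by positivity), ← Real.rpow_mul hτ,
    mul_one_div_cancel hq.ne', Real.rpow_one]

lemma l2_flatVector {τ : ℝ} (hτ : 0 ≤ τ) (S : Finset (Fin d)) :
    l2 (flatVector S τ) = √S.card * τ := by
  rw [l2, sum_flatVector_sq, Real.sqrt_mul (by positivity), Real.sqrt_sq hτ]

end Norms

section Scaling

variable {d : ℕ} {σ : ℝ}

lemma l0_smul (hσ : σ ≠ 0) (θ : Fin d → ℝ) : l0 (σ • θ) = l0 θ := by
  simp [l0, hσ]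

lemma lq_smul {q : ℝ} (hq : 0 < q) (hσ : 0 ≤ σ) (θ : Fin d → ℝ) : lq q (σ • θ) = σ * lq q θ := by
  simp only [lq, Pi.smul_apply, smul_eq_mul, abs_mul, abs_of_nonneg hσ,
    Real.mul_rpow hσ (abs_nonneg _), ← Finset.mul_sum]
  rw [Real.mul_rpow (by positivity) (by positivity), ← Real.rpow_mul hσ,
    mul_one_div_cancel hq.ne', Real.rpow_one]

lemma l2_smul (hσ : 0 ≤ σ) (θ : Fin d → ℝ) : l2 (σ • θ) = σ * l2 θ := by
  simp only [l2, Pi.smul_apply, smul_eq_mul, mul_pow, ← Finset.mul_sum]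
  rw [Real.sqrt_mul (by positivity), Real.sqrt_sq hσ]

lemma obsLaw_smul (σ : ℝ) (θ : Fin d → ℝ) :
    obsLaw σ (σ • θ) = (obsLaw 1 θ).map (σ • ·) := by
  rw [obsLaw, obsLaw, Measure.map_map (by fun_prop) (by fun_prop)]
  congr 1 with ξ j
  simp [mul_add]

lemma minimaxRisk_eq_preimage_smul (hσ : σ ≠ 0) (Θ : Set (Fin d → ℝ)) :
    minimaxRisk σ Θ = minimaxRisk 1 ((σ • ·) ⁻¹' Θ) := by
  let e : (Fin d → ℝ) ≃ᵐ (Fin d → ℝ) := MeasurableEquiv.smul₀ σ hσ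
  have hrisk (Δ : (Fin d → ℝ) → Fin 2) : testRisk σ Θ Δ = testRisk 1 (e ⁻¹' Θ) (Δ ∘ e) := by
    have hobs (h : Fin d → ℝ) (i : Fin 2) :
        obsLaw σ (e h) {y | Δ y = i} = obsLaw 1 h {y | (Δ ∘ e) y = i} := by
      rw [show e h = σ • h from rfl, obsLaw_smul]
      exact e.map_apply _
    have hzero : e 0 = 0 := smul_zero σ
    rw [testRisk, testRisk, ← hobs, hzero]
    congr 1
    simp only [← hobs, Set.mem_preimage]
    exact (e.surjective.iSup_comp fun θ => ⨆ _ : θ ∈ Θ, obsLaw σ θ {y | Δ y = 0}).symm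
  refine le_antisymm (le_iInf₂ fun Δ hΔ => ?_) (le_iInf₂ fun Δ hΔ => ?_)
  · refine (iInf₂_le (Δ ∘ e.symm) (hΔ.comp e.symm.measurable)).trans_eq ?_
    rw [hrisk, Function.comp_assoc, e.symm_comp_self, Function.comp_id]
    rfl
  · exact (iInf₂_le (Δ ∘ e) (hΔ.comp e.measurable)).trans_eq (hrisk Δ).symm

lemma psiSparse_eq_sq_mul (d s : ℕ) (σ : ℝ) : psiSparse d s σ = σ ^ 2 * psiSparse d s 1 := by
  unfold psiSparse
  split_ifs <;> ring

lemma effSparsity_eq_div (q r : ℝ) (hσ : 0 < σ) :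
    effSparsity d q r σ = effSparsity d q (r / σ) 1 := by
  have hiff (t : ℕ) : σ ^ 2 * Real.log (1 + d / (t : ℝ) ^ 2) ≤ r ^ 2 * (t : ℝ) ^ (-2 / q) ↔
      1 ^ 2 * Real.log (1 + d / (t : ℝ) ^ 2) ≤ (r / σ) ^ 2 * (t : ℝ) ^ (-2 / q) := by
    rw [div_pow, div_mul_eq_mul_div, le_div_iff₀ (by positivity)]
    ring_nf
  simp only [effSparsity, hiff]

lemma psiBall_eq_sq_mul (d : ℕ) (q r : ℝ) (hσ : 0 < σ) :
    psiBall d q r σ = σ ^ 2 * psiBall d q (r / σ) 1 := by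
  simp only [psiBall, effSparsity_eq_div q r hσ]
  split_ifs
  · ring
  · ring
  · field_simp

lemma minimaxRisk_sparseAlt_eq (hσ : 0 < σ) (s : ℕ) (A : ℝ) :
    minimaxRisk σ (sparseAlt d s (A * √(psiSparse d s σ))) =
      minimaxRisk 1 (sparseAlt d s (A * √(psiSparse d s 1))) := by
  rw [minimaxRisk_eq_preimage_smul hσ.ne']
  congr 1 with θ
  simp only [sparseAlt, Set.preimage_ofPred_eq, Set.mem_ofPred_eq, l0_smul hσ.ne', l2_smul hσ.le]
  rw [psiSparse_eq_sq_mul, Real.sqrt_mul (by positivity), Real.sqrt_sq hσ.le, mul_left_comm,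
    mul_le_mul_iff_right₀ hσ]

lemma minimaxRisk_ballAlt_eq {q : ℝ} (hq : 0 < q) (hσ : 0 < σ) (r A : ℝ) :
    minimaxRisk σ (ballAlt d q r (A * √(psiBall d q r σ))) =
      minimaxRisk 1 (ballAlt d q (r / σ) (A * √(psiBall d q (r / σ) 1))) := by
  rw [minimaxRisk_eq_preimage_smul hσ.ne']
  congr 1 with θ
  simp only [ballAlt, Set.preimage_ofPred_eq, Set.mem_ofPred_eq, lq_smul hq hσ.le, l2_smul hσ.le]
  rw [psiBall_eq_sq_mul d q r hσ, Real.sqrt_mul (by positivity), Real.sqrt_sq hσ.le, mul_left_comm,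
    mul_le_mul_iff_right₀ hσ, le_div_iff₀' hσ]

end Scaling

section Rates

variable {d : ℕ}

lemma psiSparse_one_of_lt_sqrt {s : ℕ} (h : (s : ℝ) < √d) :
    psiSparse d s 1 = s * sparseLog d s := by
  simp [psiSparse, sparseLog, h]

lemma psiSparse_one_of_sqrt_le {s : ℕ} (h : √d ≤ s) : psiSparse d s 1 = √d := by
  simp [psiSparse, h.not_gt]

lemma sq_le_of_natCast_le_sqrt {s : ℕ} (h : (s : ℝ) ≤ √d) : s ^ 2 ≤ d := by
  exact_mod_cast (Real.le_sqrt (Nat.cast_nonneg s) (Nat.cast_nonneg d)).1 h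

lemma sparseLog_pos {s : ℕ} (hs : 1 ≤ s) (hd : 1 ≤ d) : 0 < sparseLog d s :=
  Real.log_pos <| lt_add_of_pos_right _ <| by positivity

lemma psiSparse_pos {s : ℕ} {σ : ℝ} (hs : 1 ≤ s) (hd : 1 ≤ d) (hσ : σ ≠ 0) :
    0 < psiSparse d s σ := by
  suffices 0 < psiSparse d s 1 by
    rw [psiSparse_eq_sq_mul]
    positivity
  rcases lt_or_ge (s : ℝ) √d with h | h
  · have := sparseLog_pos hs hd
    rw [psiSparse_one_of_lt_sqrt h]
    positivity
  · rw [psiSparse_one_of_sqrt_le h]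
    positivity

lemma one_le_natSqrt (hd : 1 ≤ d) : 1 ≤ Nat.sqrt d :=
  Nat.sqrt_pos.2 hd

lemma sqrt_le_natSqrt_mul_sparseLog (hd : 1 ≤ d) :
    √d ≤ 4 * (Nat.sqrt d * sparseLog d (Nat.sqrt d)) := by
  have hfloor : √d ≤ Nat.sqrt d + 1 := Real.real_sqrt_le_nat_sqrt_succ
  have hone : (1 : ℝ) ≤ Nat.sqrt d := by exact_mod_cast one_le_natSqrt hd
  have hlog := half_le_sparseLog (one_le_natSqrt hd) (Nat.sqrt_le' d)
  nlinarith

/-- Flat vectors with `s` entries of size `√(sparseLog d s)` lie in the ball `B_q(r)`. For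
`s ≥ 1` and `r ≥ 0` this is the inequality `log (1 + d/s²) ≤ r² s^(-2/q)` that defines the effective
sparsity at noise level `1`. -/
def FitsBall (d : ℕ) (q r : ℝ) (s : ℕ) : Prop := (s : ℝ) ^ (1 / q) * √(sparseLog d s) ≤ r

lemma fitsBall_iff {q r : ℝ} (hr : 0 ≤ r) {s : ℕ} (hs : 1 ≤ s) :
    FitsBall d q r s ↔ 1 ^ 2 * Real.log (1 + d / (s : ℝ) ^ 2) ≤ r ^ 2 * (s : ℝ) ^ (-2 / q) := by
  have hs0 : (0 : ℝ) < s := by exact_mod_cast hs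
  have hL : 0 ≤ sparseLog d s :=
    Real.log_nonneg <| le_add_of_nonneg_right <| by positivity
  have hpow : (s : ℝ) ^ (-2 / q) = (((s : ℝ) ^ (1 / q)) ^ 2)⁻¹ := by
    rw [← Real.rpow_mul_natCast hs0.le, ← Real.rpow_neg hs0.le]
    congr 1
    push_cast
    ring
  rw [FitsBall, ← sq_le_sq₀ (by positivity) hr, mul_pow, Real.sq_sqrt hL, hpow,
    ← div_eq_mul_inv, le_div_iff₀ (by positivity), one_pow, one_mul, mul_comm, sparseLog]

lemma natCast_le_effSparsity_iff {q r : ℝ} (hr : 0 ≤ r) {s : ℕ} (hs : 1 ≤ s) :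
    (s : ℕ∞) ≤ effSparsity d q r 1 ↔ ∀ t, 1 ≤ t → t ≤ s → FitsBall d q r t := by
  have hiff : (∀ t, 1 ≤ t → t ≤ s → FitsBall d q r t) ↔ ∀ t : ℕ, 1 ≤ t → t ≤ s →
      1 ^ 2 * Real.log (1 + d / (t : ℝ) ^ 2) ≤ r ^ 2 * (t : ℝ) ^ (-2 / q) :=
    forall₃_congr fun t ht _ => fitsBall_iff hr ht
  rw [hiff]
  refine ⟨fun h => ?_, fun h =>
    le_iSup₂_of_le (f := fun (s : ℕ) _ => (s : ℕ∞)) s ⟨hs, h⟩ le_rfl⟩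
  by_contra hfail
  have hle : effSparsity d q r 1 ≤ (s - 1 : ℕ) := by
    refine iSup₂_le fun s' hs' => Nat.cast_le.2 <| Nat.le_sub_one_of_lt ?_
    by_contra! hss'
    exact hfail fun t ht hts => hs'.2 t ht (hts.trans hss')
  have : s ≤ s - 1 := by exact_mod_cast h.trans hle
  lia

lemma fitsBall_of_effSparsity_eq {q r : ℝ} (hr : 0 ≤ r) {m : ℕ} (hm : effSparsity d q r 1 = m)
    (hm1 : 1 ≤ m) : FitsBall d q r m :=
  (natCast_le_effSparsity_iff hr hm1).1 hm.ge m hm1 le_rfl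

lemma not_fitsBall_succ_of_effSparsity_eq {q r : ℝ} (hr : 0 ≤ r) {m : ℕ}
    (hm : effSparsity d q r 1 = m) : ¬ FitsBall d q r (m + 1) := by
  intro hfit
  have hall : ∀ t, 1 ≤ t → t ≤ m + 1 → FitsBall d q r t := by
    intro t ht htm
    rcases htm.eq_or_lt with rfl | hlt
    · exact hfit
    · exact (natCast_le_effSparsity_iff hr (by lia)).1 hm.ge t ht (by lia)
  have := (natCast_le_effSparsity_iff hr (by lia)).2 hall
  rw [hm, Nat.cast_le] at this
  lia

lemma psiBall_cases {q r : ℝ} (hd : 1 ≤ d) (hr : 0 ≤ r) :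
    (psiBall d q r 1 = √d ∧ FitsBall d q r (Nat.sqrt d)) ∨
      (∃ m : ℕ, 1 ≤ m ∧ m ^ 2 ≤ d ∧ psiBall d q r 1 = m * sparseLog d m ∧
        FitsBall d q r m ∧ ¬ FitsBall d q r (m + 1)) ∨
      (psiBall d q r 1 = r ^ 2 ∧ ¬ FitsBall d q r 1) := by
  by_cases hdense : effSparsity d q r 1 = ⊤ ∨ √d < ((effSparsity d q r 1).toNat : ℝ)
  · have hle : (Nat.sqrt d : ℕ∞) ≤ effSparsity d q r 1 := by
      rcases hdense with htop | hlt
      · simp [htop]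
      · refine le_trans ?_ (ENat.natCast_toNat_le_self _)
        exact_mod_cast Real.nat_sqrt_le_real_sqrt.trans hlt.le
    have hd' := one_le_natSqrt hd
    exact .inl ⟨by simp [psiBall, hdense],
      (natCast_le_effSparsity_iff hr hd').1 hle _ hd' le_rfl⟩
  obtain ⟨m, hm⟩ := ENat.ne_top_iff_exists.1 fun htop => hdense (.inl htop)
  have hψ : psiBall d q r 1 = if 1 ≤ m then m * sparseLog d m else r ^ 2 := by
    simp only [psiBall, if_neg hdense]
    simp [← hm, sparseLog]
  have hmd : (m : ℝ) ≤ √d := by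
    have := not_lt.1 fun hlt => hdense (.inr hlt)
    rwa [← hm, ENat.toNat_natCast] at this
  have hfail := not_fitsBall_succ_of_effSparsity_eq hr hm.symm
  rcases Nat.eq_zero_or_pos m with rfl | (hm1 : 1 ≤ m)
  · exact .inr (.inr ⟨by simpa using hψ, hfail⟩)
  · exact .inr (.inl ⟨m, hm1, sq_le_of_natCast_le_sqrt hmd, by rw [hψ, if_pos hm1],
      fitsBall_of_effSparsity_eq hr hm.symm hm1, hfail⟩)

lemma psiBall_one_pos {q r : ℝ} (hd : 1 ≤ d) (hr : 0 < r) : 0 < psiBall d q r 1 := by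
  rcases psiBall_cases (q := q) hd hr.le with ⟨h, -⟩ | ⟨m, hm, -, h, -⟩ | ⟨h, -⟩ <;> rw [h]
  · positivity
  · have := sparseLog_pos hm hd
    positivity
  · positivity

lemma psiBall_pos {q r σ : ℝ} (hd : 1 ≤ d) (hr : 0 < r) (hσ : 0 < σ) : 0 < psiBall d q r σ := by
  rw [psiBall_eq_sq_mul d q r hσ]
  have := psiBall_one_pos (q := q) hd (div_pos hr hσ)
  positivity

lemma rpow_le_of_not_fitsBall_succ {q r : ℝ} (hq : 0 < q) (hr : 0 ≤ r) {m : ℕ} (hm : 1 ≤ m)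
    (h : ¬ FitsBall d q r (m + 1)) : r ^ q ≤ 2 * m * √(sparseLog d m) ^ q := by
  have hm1 : (1 : ℝ) ≤ m := by exact_mod_cast hm
  have hlog : sparseLog d (m + 1) ≤ sparseLog d m := by
    unfold sparseLog
    gcongr
    simp
  calc r ^ q ≤ (((m + 1 : ℕ) : ℝ) ^ (1 / q) * √(sparseLog d (m + 1))) ^ q := by
        gcongr
        exact (not_le.1 h).le
    _ = ((m + 1 : ℕ) : ℝ) * √(sparseLog d (m + 1)) ^ q := by
        rw [Real.mul_rpow (by positivity) (by positivity), ← Real.rpow_mul (by positivity),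
          one_div_mul_cancel hq.ne', Real.rpow_one]
    _ ≤ 2 * m * √(sparseLog d m) ^ q := by
        gcongr
        push_cast
        linarith

lemma sum_sq_le_of_not_fitsBall_succ {q r : ℝ} (hq : 0 < q) (hq2 : q ≤ 2) (hr : 0 ≤ r) {m : ℕ}
    (hm : 1 ≤ m) (h : ¬ FitsBall d q r (m + 1)) {θ : Fin d → ℝ} (hθ : lq q θ ≤ r) :
    ∑ j with |θ j| ≤ 8 * √(sparseLog d m), θ j ^ 2 ≤ 128 * (m * sparseLog d m) := by
  set L := sparseLog d m
  have hL : 0 ≤ L := Real.log_nonneg <| le_add_of_nonneg_right <| by positivity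
  calc ∑ j with |θ j| ≤ 8 * √L, θ j ^ 2 ≤ (8 * √L) ^ (2 - q) * r ^ q :=
        sum_sq_le_of_lq_le hq hq2 (by positivity) hθ
    _ ≤ (8 * √L) ^ (2 - q) * (2 * m * √L ^ q) := by
        gcongr
        exact rpow_le_of_not_fitsBall_succ hq hr hm h
    _ = 2 * m * 8 ^ (2 - q) * (√L ^ (2 - q) * √L ^ q) := by
        rw [Real.mul_rpow (by norm_num) (by positivity)]
        ring
    _ = 2 * m * 8 ^ (2 - q) * L := by
        rw [← Real.rpow_add_of_nonneg (by positivity) (by linarith) hq.le, sub_add_cancel,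
          Real.rpow_two, Real.sq_sqrt hL]
    _ ≤ 2 * m * 8 ^ (2 : ℝ) * L := by
        gcongr
        · norm_num
        · linarith
    _ = 128 * (m * L) := by
        norm_num
        ring

end Rates

section MinimaxRates

variable {d : ℕ}

lemma minimaxRisk_empty (σ : ℝ) : minimaxRisk σ (∅ : Set (Fin d → ℝ)) = 0 := by
  refine le_antisymm ((iInf₂_le (fun _ => 0) measurable_const).trans ?_) zero_le
  simp [testRisk]

lemma sq_mul_le_sum_sq_of_le_l2 {θ : Fin d → ℝ} {A ψ : ℝ} (hA : 0 ≤ A) (hψ : 0 ≤ ψ)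
    (h : A * √ψ ≤ l2 θ) : A ^ 2 * ψ ≤ ∑ j, θ j ^ 2 := by
  rw [← l2_sq, ← Real.sq_sqrt hψ, ← mul_pow]
  gcongr

lemma minimaxRisk_sparseAlt_le {s : ℕ} {A : ℝ} (hs : 1 ≤ s) (hd : 1 ≤ d) (hA : 16 ≤ A) :
    minimaxRisk 1 (sparseAlt d s (A * √(psiSparse d s 1))) ≤
      ENNReal.ofReal (4096 * varConst / A ^ 2) := by
  have hsep : ∀ θ ∈ sparseAlt d s (A * √(psiSparse d s 1)),
      A ^ 2 * psiSparse d s 1 ≤ ∑ j, θ j ^ 2 := fun θ hθ =>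
    sq_mul_le_sum_sq_of_le_l2 (by linarith) (psiSparse_pos hs hd one_ne_zero).le hθ.2
  rcases lt_or_ge (s : ℝ) √d with h | h
  · rw [psiSparse_one_of_lt_sqrt h] at hsep ⊢
    have hL := sparseLog_pos hs hd
    refine minimaxRisk_le_of_mul_sparseLog_le hs (sq_le_of_natCast_le_sqrt h.le) hA hsep
      fun θ hθ => (sum_sq_le_of_l0_le hθ.1).trans ?_
    rw [mul_pow, Real.sq_sqrt hL.le]
    nlinarith [mul_nonneg (Nat.cast_nonneg (α := ℝ) s) hL.le]
  · rw [psiSparse_one_of_sqrt_le h] at hsep ⊢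
    exact minimaxRisk_le_of_sqrt_le hd (by linarith) hsep

lemma minimaxRisk_ballAlt_le {q r A : ℝ} (hq : 0 < q) (hq2 : q ≤ 2) (hd : 1 ≤ d) (hr : 0 < r)
    (hA : 16 ≤ A) :
    minimaxRisk 1 (ballAlt d q r (A * √(psiBall d q r 1))) ≤
      ENNReal.ofReal (4096 * varConst / A ^ 2) := by
  have hsep : ∀ θ ∈ ballAlt d q r (A * √(psiBall d q r 1)),
      A ^ 2 * psiBall d q r 1 ≤ ∑ j, θ j ^ 2 := fun θ hθ =>
    sq_mul_le_sum_sq_of_le_l2 (by linarith) (psiBall_one_pos hd hr).le hθ.2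
  rcases psiBall_cases (q := q) hd hr.le with ⟨h, -⟩ | ⟨m, hm, hmd, h, -, hfail⟩ | ⟨h, -⟩ <;>
    rw [h] at hsep ⊢
  · exact minimaxRisk_le_of_sqrt_le hd (by linarith) hsep
  · exact minimaxRisk_le_of_mul_sparseLog_le hm hmd hA hsep fun θ hθ =>
      sum_sq_le_of_not_fitsBall_succ hq hq2 hr.le hm hfail hθ.1
  · have hempty : ballAlt d q r (A * √(r ^ 2)) = ∅ := by
      refine Set.eq_empty_of_forall_notMem fun θ hθ => ?_
      have hl2 : A * r ≤ l2 θ := by simpa only [Real.sqrt_sq hr.le] using hθ.2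
      nlinarith [l2_le_of_lq_le hq hq2 hr.le hθ.1]
    rw [hempty, minimaxRisk_empty]
    exact zero_le

lemma sq_two_mul_sqrt_le {ε A L : ℝ} (hA : 0 ≤ A) (hAε : A ≤ spikeScale ε / 2) (hL : 0 ≤ L) :
    (2 * A * √L) ^ 2 ≤ spikeScale ε * L := by
  rw [mul_pow, Real.sq_sqrt hL]
  gcongr
  nlinarith [spikeScale_le_one ε]

lemma mul_sqrt_le_l2_flatVector {s : ℕ} {A L ψ : ℝ} (hA : 0 ≤ A) (hψ : ψ ≤ 4 * (s * L))
    {S : Finset (Fin d)} (hS : S.card = s) : A * √ψ ≤ l2 (flatVector S (2 * A * √L)) := by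
  have hsqrt : √ψ ≤ 2 * (√s * √L) := by
    calc √ψ ≤ √(2 ^ 2 * (s * L)) := Real.sqrt_le_sqrt (by linarith)
      _ = 2 * (√s * √L) := by
        rw [Real.sqrt_mul (by norm_num), Real.sqrt_sq (by norm_num), Real.sqrt_mul (by positivity)]
  rw [l2_flatVector (by positivity), hS]
  calc A * √ψ ≤ A * (2 * (√s * √L)) := by gcongr
    _ = √s * (2 * A * √L) := by ring

lemma le_minimaxRisk_sparseAlt {s : ℕ} {ε A : ℝ} (hs : 1 ≤ s) (hd : 1 ≤ d) (hε : 0 ≤ ε)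
    (hA : 0 ≤ A) (hAε : A ≤ spikeScale ε / 2) :
    ENNReal.ofReal (1 - ε) ≤ minimaxRisk 1 (sparseAlt d s (A * √(psiSparse d s 1))) := by
  obtain ⟨s', hs', hs's, hs'd, hψ⟩ : ∃ s', 1 ≤ s' ∧ s' ≤ s ∧ s' ^ 2 ≤ d ∧
      psiSparse d s 1 ≤ 4 * (s' * sparseLog d s') := by
    rcases lt_or_ge (s : ℝ) √d with h | h
    · refine ⟨s, hs, le_rfl, sq_le_of_natCast_le_sqrt h.le, ?_⟩
      have := sparseLog_pos hs hd
      rw [psiSparse_one_of_lt_sqrt h]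
      exact le_mul_of_one_le_left (by positivity) (by norm_num)
    · refine ⟨Nat.sqrt d, one_le_natSqrt hd, ?_, Nat.sqrt_le' d, ?_⟩
      · exact_mod_cast Real.nat_sqrt_le_real_sqrt.trans h
      · rw [psiSparse_one_of_sqrt_le h]
        exact sqrt_le_natSqrt_mul_sparseLog hd
  exact le_minimaxRisk_of_flatVector_mem hs' hs'd hε
    (sq_two_mul_sqrt_le hA hAε (sparseLog_pos hs' hd).le) fun S hS =>
      ⟨(l0_flatVector_le S _).trans (hS.trans_le hs's), mul_sqrt_le_l2_flatVector hA hψ hS⟩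

lemma le_minimaxRisk_ballAlt_of_fitsBall {s : ℕ} {q r ε A ψ : ℝ} (hq : 0 < q) (hs : 1 ≤ s)
    (hsd : s ^ 2 ≤ d) (hfit : FitsBall d q r s) (hψ : ψ ≤ 4 * (s * sparseLog d s)) (hε : 0 ≤ ε)
    (hA : 0 ≤ A) (hAε : A ≤ spikeScale ε / 2) :
    ENNReal.ofReal (1 - ε) ≤ minimaxRisk 1 (ballAlt d q r (A * √ψ)) := by
  have hL := half_le_sparseLog hs hsd
  refine le_minimaxRisk_of_flatVector_mem hs hsd hε (sq_two_mul_sqrt_le hA hAε (by linarith))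
    fun S hS => ⟨?_, mul_sqrt_le_l2_flatVector hA hψ hS⟩
  rw [lq_flatVector hq (by positivity), hS]
  calc (s : ℝ) ^ (1 / q) * (2 * A * √(sparseLog d s))
      ≤ (s : ℝ) ^ (1 / q) * (1 * √(sparseLog d s)) := by
        gcongr
        linarith [spikeScale_le_one ε]
    _ ≤ r := by rwa [one_mul]

lemma le_minimaxRisk_ballAlt_of_not_fitsBall_one {q r ε A : ℝ} (hq : 0 < q) (hd : 1 ≤ d)
    (hr : 0 ≤ r) (hfail : ¬ FitsBall d q r 1) (hε : 0 ≤ ε) (hA : 0 ≤ A)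
    (hAε : A ≤ spikeScale ε / 2) :
    ENNReal.ofReal (1 - ε) ≤ minimaxRisk 1 (ballAlt d q r (A * √(r ^ 2))) := by
  have hrL : r ≤ √(sparseLog d 1) := by
    simpa [FitsBall] using (not_le.1 hfail).le
  rw [Real.sqrt_sq hr]
  refine le_minimaxRisk_of_flatVector_mem le_rfl (by simpa using hd) hε (τ := A * r) ?_
    fun S hS => ⟨?_, ?_⟩
  · calc (A * r) ^ 2 ≤ (2 * A * √(sparseLog d 1)) ^ 2 := by
          gcongr
          linarith
      _ ≤ spikeScale ε * sparseLog d 1 :=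
          sq_two_mul_sqrt_le hA hAε (sparseLog_pos le_rfl hd).le
  · rw [lq_flatVector hq (by positivity), hS, Nat.cast_one, Real.one_rpow, one_mul]
    exact mul_le_of_le_one_left hr (by linarith [spikeScale_le_one ε])
  · simp [l2_flatVector (mul_nonneg hA hr), hS]

lemma le_minimaxRisk_ballAlt {q r ε A : ℝ} (hq : 0 < q) (hd : 1 ≤ d) (hr : 0 < r) (hε : 0 ≤ ε)
    (hA : 0 ≤ A) (hAε : A ≤ spikeScale ε / 2) :
    ENNReal.ofReal (1 - ε) ≤ minimaxRisk 1 (ballAlt d q r (A * √(psiBall d q r 1))) := by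
  rcases psiBall_cases (q := q) hd hr.le with ⟨h, hfit⟩ | ⟨m, hm, hmd, h, hfit, -⟩ | ⟨h, hfail⟩ <;>
    rw [h]
  · exact le_minimaxRisk_ballAlt_of_fitsBall hq (one_le_natSqrt hd) (Nat.sqrt_le' d) hfit
      (sqrt_le_natSqrt_mul_sparseLog hd) hε hA hAε
  · have := sparseLog_pos hm hd
    exact le_minimaxRisk_ballAlt_of_fitsBall hq hm hmd hfit
      (le_mul_of_one_le_left (by positivity) (by norm_num)) hε hA hAε
  · exact le_minimaxRisk_ballAlt_of_not_fitsBall_one hq hd hr.le hfail hε hA hAε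

end MinimaxRates

end SparseTesting

open SparseTesting in
theorem theorem10_general :
    ((∀ (d s : ℕ) (σ : ℝ), 1 ≤ s → 1 ≤ d → 0 < σ → 0 < √(psiSparse d s σ)) ∧
      (∀ ε : ℝ, 0 < ε → ∃ Aε : ℝ, 0 < Aε ∧
        ∀ (d s : ℕ) (σ : ℝ), 1 ≤ s → 1 ≤ d → 0 < σ → ∀ A : ℝ, Aε < A →
          minimaxRisk σ (sparseAlt d s (A * √(psiSparse d s σ))) ≤ ENNReal.ofReal ε) ∧
      (∀ ε : ℝ, 0 < ε → ∃ aε : ℝ, 0 < aε ∧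
        ∀ (d s : ℕ) (σ : ℝ), 1 ≤ s → 1 ≤ d → 0 < σ → ∀ A : ℝ, 0 < A → A < aε →
          ENNReal.ofReal (1 - ε) ≤
            minimaxRisk σ (sparseAlt d s (A * √(psiSparse d s σ))))) ∧
    ((∀ (q : ℝ) (d : ℕ) (r σ : ℝ), 1 ≤ d → 0 < r → 0 < σ → 0 < √(psiBall d q r σ)) ∧
      (∀ ε : ℝ, 0 < ε → ∃ Aε : ℝ, 0 < Aε ∧
        ∀ q : ℝ, 0 < q → q ≤ 2 → ∀ (d : ℕ) (r σ : ℝ), 1 ≤ d → 0 < r → 0 < σ → ∀ A : ℝ, Aε < A →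
          minimaxRisk σ (ballAlt d q r (A * √(psiBall d q r σ))) ≤ ENNReal.ofReal ε) ∧
      (∀ ε : ℝ, 0 < ε → ∃ aε : ℝ, 0 < aε ∧
        ∀ q : ℝ, 0 < q → ∀ (d : ℕ) (r σ : ℝ), 1 ≤ d → 0 < r → 0 < σ →
          ∀ A : ℝ, 0 < A → A < aε →
            ENNReal.ofReal (1 - ε) ≤
              minimaxRisk σ (ballAlt d q r (A * √(psiBall d q r σ))))) := by
  refine ⟨⟨fun d s σ hs hd hσ => Real.sqrt_pos.2 (psiSparse_pos hs hd hσ.ne'),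
      fun ε hε => ⟨upperScale ε, upperScale_pos hε, fun d s σ hs hd hσ A hA => ?_⟩,
      fun ε hε => ⟨spikeScale ε / 2, half_pos (spikeScale_pos hε),
        fun d s σ hs hd hσ A hA hAε => ?_⟩⟩,
    fun q d r σ hd hr hσ => Real.sqrt_pos.2 (psiBall_pos hd hr hσ),
    fun ε hε => ⟨upperScale ε, upperScale_pos hε, fun q hq hq2 d r σ hd hr hσ A hA => ?_⟩,
    fun ε hε => ⟨spikeScale ε / 2, half_pos (spikeScale_pos hε),
      fun q hq d r σ hd hr hσ A hA hAε => ?_⟩⟩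
  · rw [minimaxRisk_sparseAlt_eq hσ]
    exact (minimaxRisk_sparseAlt_le hs hd ((sixteen_lt_upperScale hε).trans hA).le).trans
      (ofReal_varConst_div_le hε hA)
  · rw [minimaxRisk_sparseAlt_eq hσ]
    exact le_minimaxRisk_sparseAlt hs hd hε.le hA.le hAε.le
  · rw [minimaxRisk_ballAlt_eq hq hσ]
    exact (minimaxRisk_ballAlt_le hq hq2 hd (div_pos hr hσ)
      ((sixteen_lt_upperScale hε).trans hA).le).trans (ofReal_varConst_div_le hε hA)
  · rw [minimaxRisk_ballAlt_eq hq hσ]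
    exact le_minimaxRisk_ballAlt hq hd (div_pos hr hσ) hε.le hA.le hAε.le

theorem theorem10 :
    -- the classes `B_0(s)`: positivity of the rate, upper bound, lower bound
    ((∀ (d s : ℕ) (σ : ℝ), 1 ≤ s → s ≤ d → 0 < σ → 0 < √(SparseTesting.psiSparse d s σ)) ∧
      (∀ ε : ℝ, 0 < ε → ε < 1 → ∃ Aε : ℝ, 0 < Aε ∧
        ∀ (d s : ℕ) (σ : ℝ), 1 ≤ s → s ≤ d → 0 < σ → ∀ A : ℝ, Aε < A →
          SparseTesting.minimaxRisk σ
              (SparseTesting.sparseAlt d s (A * √(SparseTesting.psiSparse d s σ))) ≤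
            ENNReal.ofReal ε) ∧
      (∀ ε : ℝ, 0 < ε → ε < 1 → ∃ aε : ℝ, 0 < aε ∧
        ∀ (d s : ℕ) (σ : ℝ), 1 ≤ s → s ≤ d → 0 < σ → ∀ A : ℝ, 0 < A → A < aε →
          ENNReal.ofReal (1 - ε) ≤
            SparseTesting.minimaxRisk σ
              (SparseTesting.sparseAlt d s (A * √(SparseTesting.psiSparse d s σ))))) ∧
    -- the classes `B_q(r)`, `0 < q < 2`: the same, with constants that may depend on `q`
    (∀ q : ℝ, 0 < q → q < 2 →
      (∀ (d : ℕ) (r σ : ℝ), 1 ≤ d → 0 < r → 0 < σ → 0 < √(SparseTesting.psiBall d q r σ)) ∧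
      (∀ ε : ℝ, 0 < ε → ε < 1 → ∃ Aε : ℝ, 0 < Aε ∧
        ∀ (d : ℕ) (r σ : ℝ), 1 ≤ d → 0 < r → 0 < σ → ∀ A : ℝ, Aε < A →
          SparseTesting.minimaxRisk σ
              (SparseTesting.ballAlt d q r (A * √(SparseTesting.psiBall d q r σ))) ≤
            ENNReal.ofReal ε) ∧
      (∀ ε : ℝ, 0 < ε → ε < 1 → ∃ aε : ℝ, 0 < aε ∧
        ∀ (d : ℕ) (r σ : ℝ), 1 ≤ d → 0 < r → 0 < σ → ∀ A : ℝ, 0 < A → A < aε →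
          ENNReal.ofReal (1 - ε) ≤
            SparseTesting.minimaxRisk σ
              (SparseTesting.ballAlt d q r (A * √(SparseTesting.psiBall d q r σ))))) := by
  obtain ⟨⟨hpos, hupper, hlower⟩, hpos', hupper', hlower'⟩ := theorem10_general
  exact ⟨⟨fun d s σ hs hsd => hpos d s σ hs (hs.trans hsd),
      fun ε hε _ => (hupper ε hε).imp fun _ h =>
        ⟨h.1, fun d s σ hs hsd => h.2 d s σ hs (hs.trans hsd)⟩,
      fun ε hε _ => (hlower ε hε).imp fun _ h =>
        ⟨h.1, fun d s σ hs hsd => h.2 d s σ hs (hs.trans hsd)⟩⟩,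
    fun q hq hq2 => ⟨hpos' q,
      fun ε hε _ => (hupper' ε hε).imp fun _ h => ⟨h.1, h.2 q hq hq2.le⟩,
      fun ε hε _ => (hlower' ε hε).imp fun _ h => ⟨h.1, h.2 q hq⟩⟩⟩
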